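/- Let $\Bbbk$ be an algebraically closed field of characteristic zero and let $r$ be a positive integer. For a positive integer $n$ let $\Gamma(n)$ be the kernel of the reduction map $SL_2(\mathbb{Z}) \to SL_2(\mathbb{Z}/n\mathbb{Z})$; a subgroup $L$ of $SL_2(\mathbb{Z})$ is called a congruence subgroup of level $n$ if $n$ is the least positive integer with $\Gamma(n) \le L$. Let $\eta : GL_r(\Bbbk) \to PGL_r(\Bbbk)$ be the natural surjection. **Theorem 2.3.** Suppose that $\bar\rho : SL_2(\mathbb{Z}) \to PGL_r(\Bbbk)$ is a projective representation (a group homomorphism) such that $\ker \bar\rho$ is a congruence subgroup of level $n$. Then for every lifting of $\bar\rho$, i.e. every group homomorphism $\rho : SL_2(\mathbb{Z}) \to GL_r(\Bbbk)$ with $\eta \circ \rho = \bar\rho$, the kernel $\ker\rho$ is a congruence subgroup of some level $m$ with $n \mid m \mid 12n$. -/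

import Mathlib

open scoped MatrixGroups

/-- A subgroup `L` of `SL(2, ℤ)` is a congruence subgroup of level `n` if `n` is the least
positive integer for which `L` contains the principal congruence subgroup `Γ(n)`, the kernel of
reduction modulo `n`. -/
def IsCongruenceSubgroupOfLevel (L : Subgroup SL(2, ℤ)) (n : ℕ) : Prop :=
  IsLeast {m : ℕ | 0 < m ∧ CongruenceSubgroup.Gamma m ≤ L} n

/-- A lifting of a projective representation `ρbar : G → PGL_r(k)` is an ordinary representation
`ρ : G → GL_r(k)` whose composition with the natural surjection `GL_r(k) → PGL_r(k)` is `ρbar`. -/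
def IsLinearLifting {G k : Type*} [Group G] [Field k] {r : ℕ}
    (ρ : G →* GL (Fin r) k) (ρbar : G →* Matrix.ProjGenLinGroup (Fin r) k) : Prop :=
  Matrix.ProjGenLinGroup.mk.comp ρ = ρbar

/-!
The idea is that a homomorphism `SL₂(ℤ) → PGL_r(k)` that factors through `SL₂(ℤ/n)` has a linear
lift that factors through `SL₂(ℤ/m)` for some `m ∣ 12 n`, and that two linear lifts differ by a
character of `SL₂(ℤ)`, which is trivial on `Γ(12)`. Hence every lift `ρ` is trivial on `Γ(12 n)`
(`IsScalarExtension.apply_eq_one_of_mem_Gamma`). Since `Γ(gcd(a, b)) ⊆ Γ(a) Γ(b)`, the positive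
integers `a` with `Γ(a) ≤ ker ρ` are the multiples of the level, which gives both divisibilities.

Everything takes place in a central extension `kˣ → G → Q` with `k` algebraically closed, such as
`GL_r(k) → PGL_r(k)`.

*Prime powers.* Let `ψ : SL₂(ℤ/pᵃ) → Q`. A linear lift is built over `SL₂(ℤ/m)`, where `m` is
`pᵃ`, `3 pᵃ` or `4 pᵃ` according as `p ≥ 5`, `p = 3` or `p = 2`. Let `t` be a lift of the image of
the matrix `x(1) = (1, 1; 0, 1)` with `t ^ m = 1`. Conjugation by a lift of `diag(u, u⁻¹)` sends
`t` to `t ^ (u²)` up to a scalar `z`, and `t` can be adjusted by a root of unity so as to remove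
`z`; here `u` is a primitive root modulo `m`, or `5` if `p = 2`. What makes this possible is that
the order of `z` divides `m / d`, where `d` is the largest power of `p` dividing `u² - 1`, so that
`z` is the `(u² - 1)`-th power of an `m`-th root of unity. The powers of the adjusted `t` then
form a one-parameter group `X(b)` on which the torus acts as in `SL₂`. The torus elements `H(u)`,
words in `X` and its conjugate `Y` under the Weyl element, commute with each other, and it remains
to see that `H` is multiplicative: then the Bruhat normal form shows that the relations of
`SL₂(ℤ/m)` hold in `G` (`RootPair.IsSteinberg.exists_hom`). Multiplicativity is a statement about
symbols in the sense of Steinberg and Matsumoto. For odd `p` it follows from the relation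
`{u, 1 - u} = 1` and the existence of two nonsquare units with sum `1`. For `p = 2` it follows from
two expansions of `x(a) y(2)`, along `2 = 1 + 1` and along `2 = 3 + (-1)`, provided that
`H(-1)² = 1`; in general `H(-1)²` is `±1`, and the sign is removed by multiplying `t` by an eighth
root of unity.

*All levels.* By induction on `n` one splits off a prime power `q`. The lifts of the images of the
two factors of `SL₂(ℤ/q) × SL₂(ℤ/n')` commute, since both are generated by conjugates of images of
powers of `T`. Dividing the given lift by the one just built for the factor `SL₂(ℤ/q)` leaves a
linear lift of a homomorphism trivial on `Γ(n')`. At `n = 1` this lift is a character of `SL₂(ℤ)`,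
which is a product of characters of `SL₂(ℤ/3)` and `SL₂(ℤ/4)`.
-/

/-! ### Steinberg data for `SL₂` -/

/-- A one-parameter subgroup `X : R → G` together with an element `w : G`, to be thought of as the
upper unipotent group of `SL₂(R)` and the Weyl element `(0, 1; -1, 0)`. -/
structure RootPair (R G : Type*) [CommRing R] [Group G] where
  X : R → G
  w : G
  X_add : ∀ a b, X (a + b) = X a * X b

namespace RootPair

variable {R G : Type*} [CommRing R] [Group G] (D : RootPair R G)

/-- The opposite one-parameter subgroup, the conjugate of `X` by the Weyl element. The sign is that
of `SL₂(R)`, where `Y b` is the matrix `(1, 0; b, 1)`. -/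
def Y (b : R) : G := D.w * D.X (-b) * D.w⁻¹

/-- The lift `x(u) y(-u⁻¹) x(u)` of the Weyl element attached to a unit; in `SL₂(R)` it is the
matrix `(0, u; -u⁻¹, 0)`. -/
def W (u : Rˣ) : G := D.X u * D.Y (-(u⁻¹ : Rˣ)) * D.X u

/-- The torus element `W(u) w⁻¹` attached to a unit; in `SL₂(R)` it is `diag(u, u⁻¹)`. -/
def H (u : Rˣ) : G := D.W u * D.w⁻¹

/-- The relations of `SL₂(R)` that do not involve the multiplicativity of `H`: the Weyl element is
`W 1`, the torus acts on both unipotent groups as in `SL₂(R)`, and the torus elements commute with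
each other. -/
structure IsSteinberg : Prop where
  W_one : D.W 1 = D.w
  w_sq_X : ∀ b, D.w * D.w * D.X b = D.X b * (D.w * D.w)
  H_X : ∀ (u : Rˣ) b, D.H u * D.X b = D.X (u * u * b) * D.H u
  H_Y : ∀ (u : Rˣ) b, D.H u * D.Y b = D.Y ((u⁻¹ : Rˣ) * (u⁻¹ : Rˣ) * b) * D.H u
  H_comm : ∀ u v, D.H u * D.H v = D.H v * D.H u

variable {D}

lemma X_zero : D.X 0 = 1 := by
  have := D.X_add 0 0
  simpa using this

lemma X_neg (a : R) : D.X (-a) = (D.X a)⁻¹ := by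
  rw [eq_inv_iff_mul_eq_one, ← D.X_add, neg_add_cancel, X_zero]

lemma Y_add (a b : R) : D.Y (a + b) = D.Y a * D.Y b := by
  simp only [Y, neg_add, D.X_add]; group

lemma Y_neg (a : R) : D.Y (-a) = (D.Y a)⁻¹ := by
  simp only [Y, X_neg]; group

lemma w_X (b : R) : D.w * D.X b = D.Y (-b) * D.w := by
  simp [Y]

lemma W_eq (u : Rˣ) : D.W u = D.H u * D.w := by simp [H]

lemma W_neg (u : Rˣ) : D.W (-u) = (D.W u)⁻¹ := by
  simp only [W, inv_neg, Units.val_neg, X_neg, Y_neg]; group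

namespace IsSteinberg

variable (h : D.IsSteinberg)
include h

lemma H_one : D.H 1 = 1 := by simp [H, h.W_one]

lemma H_neg_one : D.H (-1) = (D.w * D.w)⁻¹ := by
  simp [H, W_neg, h.W_one]

lemma w_Y (b : R) : D.w * D.Y b = D.X (-b) * D.w := by
  have := h.w_sq_X (-b)
  simp only [Y, ← mul_assoc] at *
  rw [this]; group

lemma W_X (u : Rˣ) (b : R) : D.W u * D.X b = D.Y (-((u⁻¹ : Rˣ) * (u⁻¹ : Rˣ) * b)) * D.W u := by
  rw [W_eq, mul_assoc, w_X, ← mul_assoc, h.H_Y, mul_assoc, mul_neg]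

/-- The Weyl element of a unit can be computed with the two root subgroups interchanged. -/
lemma W_eq_Y (u : Rˣ) : D.W u = D.Y (-(u⁻¹ : Rˣ)) * D.X u * D.Y (-(u⁻¹ : Rˣ)) := by
  have h1 := h.W_X u u
  have h2 : ((u⁻¹ : Rˣ) : R) * (u⁻¹ : Rˣ) * u = (u⁻¹ : Rˣ) := by simp [mul_assoc]
  rw [h2] at h1
  rw [← mul_left_inj (D.X u), h1, W]
  group

lemma w_W (u : Rˣ) : D.w * D.W u = D.W u⁻¹ * D.w := by
  rw [h.W_eq_Y u⁻¹, W]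
  simp only [inv_inv, ← mul_assoc, w_X]
  rw [mul_assoc (D.Y _), h.w_Y, neg_neg, ← mul_assoc, mul_assoc _ D.w, w_X, ← mul_assoc]

lemma w_H (u : Rˣ) : D.w * D.H u = D.H u⁻¹ * D.w := by
  rw [← W_eq, H, ← mul_assoc, h.w_W]; group

lemma H_W (u v : Rˣ) : D.H u * D.W v = D.W (u * u * v) * D.H u := by
  have e : (u : R) * u * v = ((u * u * v : Rˣ) : R) := by simp
  have e' : ((u⁻¹ : Rˣ) : R) * (u⁻¹ : Rˣ) * -(v⁻¹ : Rˣ) = -(((u * u * v)⁻¹ : Rˣ) : R) := by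
    simp only [mul_inv, Units.val_mul]; ring
  rw [W, W, ← mul_assoc, ← mul_assoc, h.H_X, mul_assoc _ (D.H u), h.H_Y, ← mul_assoc,
    mul_assoc _ (D.H u), h.H_X, e, e']
  group

/-- Conjugating `W(v)` by `H(u)` gives `W(u² v)`; read in terms of `H`. -/
lemma H_sq_mul_eq (u v : Rˣ) : D.H (u * u * v) = D.H u * D.H v * (D.H u⁻¹)⁻¹ := by
  have h1 := h.H_W u v
  have h2 := h.w_H u
  rw [W_eq, W_eq] at h1
  rw [eq_mul_inv_iff_mul_eq, ← mul_left_inj D.w, mul_assoc, ← h2, ← mul_assoc, ← h1]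
  group

/-- The torus elements are multiplicative if one of the factors is a square. -/
lemma H_sq_mul (u v : Rˣ) : D.H (u * u * v) = D.H (u * u) * D.H v := by
  have h1 := h.H_sq_mul_eq u v
  have h2 := h.H_sq_mul_eq u 1
  rw [h.H_one] at h2
  simp only [mul_one] at h2
  have h3 : D.H v * (D.H u⁻¹)⁻¹ = (D.H u⁻¹)⁻¹ * D.H v := by
    rw [eq_inv_mul_iff_mul_eq, ← mul_assoc, h.H_comm]; group
  rw [h1, h2, mul_assoc, h3, mul_assoc]

lemma w_sq_H (u : Rˣ) : D.w * D.w * D.H u = D.H u * (D.w * D.w) := by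
  rw [mul_assoc, h.w_H, ← mul_assoc, h.w_H, inv_inv, mul_assoc]

lemma H_mul_H_neg (u : Rˣ) : D.H u * D.H (-u) = D.H (u * u) * D.H (-1) := by
  have h2 := h.H_sq_mul_eq u 1
  rw [h.H_one] at h2
  simp only [mul_one] at h2
  have h4 := h.w_H u⁻¹
  have h5 : D.w⁻¹ * (D.H u)⁻¹ = (D.H u⁻¹)⁻¹ * D.w⁻¹ := by
    rw [inv_inv] at h4
    rw [← mul_inv_rev, ← h4, mul_inv_rev]
  have h6 : D.H (-u) = (D.H u⁻¹)⁻¹ * D.w⁻¹ * D.w⁻¹ := by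
    rw [← h5, H, W_neg, W_eq]; group
  rw [h6, h2, h.H_neg_one]
  group

/-- The Bruhat decomposition of `w x(e) w` for a unit `e`. -/
lemma w_X_w (e : Rˣ) : D.w * D.X e * D.w =
    D.X (-(e⁻¹ : Rˣ)) * D.W e⁻¹ * (D.w * D.w) * D.X (-(e⁻¹ : Rˣ)) := by
  have h1 : D.W e⁻¹ = D.X (e⁻¹ : Rˣ) * D.Y (-e) * D.X (e⁻¹ : Rˣ) := by simp [W]
  rw [mul_assoc _ (D.w * D.w), h.w_sq_X, h1, w_X, X_neg]
  group

lemma W_mul_w_sq (H_mul : ∀ u v, D.H (u * v) = D.H u * D.H v) (u : Rˣ) :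
    D.W u * (D.w * D.w) = D.W (-u) := by
  have h1 := H_mul (-1) u
  have h2 := H_mul (-1) (-1)
  rw [neg_one_mul] at h1
  simp only [mul_neg, mul_one, neg_neg, h.H_one, h.H_neg_one] at h1 h2
  have h3 : D.w * D.w = (D.w * D.w)⁻¹ := by
    rw [eq_inv_iff_mul_eq_one]; simpa using congrArg (·⁻¹) h2.symm
  rw [W_eq, W_eq, h1, ← h3, h.w_sq_H]; group

/-- For a matrix `(a, b; c, d)` with `c` and `d` units, the Bruhat decompositions of the matrix and
of its product with the Weyl element are compatible. -/
lemma bruhat (H_mul : ∀ u v, D.H (u * v) = D.H u * D.H v) (a b : R) (c d : Rˣ)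
    (hdet : a * d - b * c = 1) :
    D.X (a * (c⁻¹ : Rˣ)) * D.W (-c⁻¹) * D.X (d * (c⁻¹ : Rˣ)) * D.w =
      D.X (b * (d⁻¹ : Rˣ)) * D.W d⁻¹ * D.X (-(c * (d⁻¹ : Rˣ))) := by
  have h1 := h.w_X_w (d * c⁻¹)
  have e1 : (((d * c⁻¹)⁻¹ : Rˣ) : R) = c * (d⁻¹ : Rˣ) := by simp
  rw [e1] at h1
  have e2 : D.W (-c⁻¹) * D.X (d * (c⁻¹ : Rˣ)) * D.w =
      D.H (-c⁻¹) * (D.w * D.X ((d * c⁻¹ : Rˣ) : R) * D.w) := by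
    rw [W_eq]; simp only [Units.val_mul]; group
  have e3 : D.H (-c⁻¹) * D.W (d * c⁻¹)⁻¹ = D.W (-d⁻¹) := by
    rw [W_eq, W_eq, ← mul_assoc, ← H_mul]; congr 2; simp
  have e4 : ((-c⁻¹ : Rˣ) : R) * (-c⁻¹ : Rˣ) * -(c * (d⁻¹ : Rˣ)) = -((c⁻¹ : Rˣ) * (d⁻¹ : Rˣ)) := by
    have : ((c⁻¹ : Rˣ) : R) * c = 1 := by simp
    push_cast
    linear_combination (-((c⁻¹ : Rˣ) : R) * (d⁻¹ : Rˣ)) * this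
  have e5 : a * (c⁻¹ : Rˣ) + -((c⁻¹ : Rˣ) * (d⁻¹ : Rˣ)) = b * (d⁻¹ : Rˣ) := by
    have h1 : ((c⁻¹ : Rˣ) : R) * c = 1 := by simp
    have h2 : ((d⁻¹ : Rˣ) : R) * d = 1 := by simp
    linear_combination (((c⁻¹ : Rˣ) : R) * (d⁻¹ : Rˣ)) * hdet - a * ((c⁻¹ : Rˣ) : R) * h2 +
      b * ((d⁻¹ : Rˣ) : R) * h1
  rw [mul_assoc, mul_assoc, ← mul_assoc (D.W _), e2, h1]
  simp only [← mul_assoc]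
  rw [mul_assoc _ (D.H _) (D.X _), h.H_X, e4]
  rw [← mul_assoc, ← D.X_add, e5]
  rw [mul_assoc _ (D.H _) (D.W _), e3]
  rw [mul_assoc _ D.w D.w, mul_assoc _ _ (D.w * D.w), h.W_mul_w_sq H_mul, neg_neg]

end IsSteinberg
end RootPair

/-! ### The homomorphism from `SL₂` of a local ring attached to Steinberg data -/

namespace SLTwo

variable {R : Type*} [CommRing R]

/-- The upper unipotent matrix `(1, b; 0, 1)`. -/
def x (b : R) : SL(2, R) := ⟨!![1, b; 0, 1], by simp [Matrix.det_fin_two]⟩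

/-- The Weyl element `(0, 1; -1, 0)`. -/
def wt : SL(2, R) := ⟨!![0, 1; -1, 0], by simp [Matrix.det_fin_two]⟩

/-- The diagonal matrix `diag(u, u⁻¹)`. -/
def dg (u : Rˣ) : SL(2, R) := ⟨!![(u : R), 0; 0, (u⁻¹ : Rˣ)], by simp [Matrix.det_fin_two]⟩

@[simp] lemma x_00 (b : R) : (x b) 0 0 = 1 := rfl
@[simp] lemma x_01 (b : R) : (x b) 0 1 = b := rfl
@[simp] lemma x_10 (b : R) : (x b) 1 0 = 0 := rfl
@[simp] lemma x_11 (b : R) : (x b) 1 1 = 1 := rfl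
@[simp] lemma wt_00 : (wt : SL(2, R)) 0 0 = 0 := rfl
@[simp] lemma wt_01 : (wt : SL(2, R)) 0 1 = 1 := rfl
@[simp] lemma wt_10 : (wt : SL(2, R)) 1 0 = -1 := rfl
@[simp] lemma wt_11 : (wt : SL(2, R)) 1 1 = 0 := rfl
@[simp] lemma dg_00 (u : Rˣ) : (dg u) 0 0 = u := rfl
@[simp] lemma dg_01 (u : Rˣ) : (dg u) 0 1 = 0 := rfl
@[simp] lemma dg_10 (u : Rˣ) : (dg u) 1 0 = 0 := rfl
@[simp] lemma dg_11 (u : Rˣ) : (dg u) 1 1 = (u⁻¹ : Rˣ) := rfl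

lemma mul_apply (A B : SL(2, R)) (i j : Fin 2) :
    (A * B) i j = A i 0 * B 0 j + A i 1 * B 1 j := by
  simp [Matrix.mul_apply, Fin.sum_univ_two]

lemma ext_iff' {A B : SL(2, R)} :
    A = B ↔ A 0 0 = B 0 0 ∧ A 0 1 = B 0 1 ∧ A 1 0 = B 1 0 ∧ A 1 1 = B 1 1 := by
  rw [Matrix.SpecialLinearGroup.ext_iff]
  simp [Fin.forall_fin_two, and_assoc]

lemma det_eq (A : SL(2, R)) : A 0 0 * A 1 1 - A 0 1 * A 1 0 = 1 := by
  have := A.det_coe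
  rwa [Matrix.det_fin_two] at this

lemma one_apply' : (1 : SL(2, R)) 0 0 = 1 ∧ (1 : SL(2, R)) 0 1 = 0 ∧ (1 : SL(2, R)) 1 0 = 0 ∧
    (1 : SL(2, R)) 1 1 = 1 := by simp

lemma x_add (a b : R) : x (a + b) = x a * x b := by
  simp [ext_iff', mul_apply, add_comm]

lemma x_zero : x (0 : R) = 1 := by simp [ext_iff']

lemma dg_mul (u v : Rˣ) : dg (u * v) = dg u * dg v := by
  simp [ext_iff', mul_apply, mul_comm]

lemma dg_one : dg (1 : Rˣ) = 1 := by simp [ext_iff']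

lemma dg_x (u : Rˣ) (b : R) : dg u * x b = x (u * u * b) * dg u := by
  simp [ext_iff', mul_apply, mul_comm, mul_assoc]

lemma dg_wt (u : Rˣ) : dg u * wt = wt * dg u⁻¹ := by
  simp [ext_iff', mul_apply]

lemma wt_wt : (wt * wt : SL(2, R)) = dg (-1) := by
  simp [ext_iff', mul_apply]

/-- The lower unipotent matrix `(1, 0; b, 1)`. -/
def yl (b : R) : SL(2, R) := ⟨!![1, 0; b, 1], by simp [Matrix.det_fin_two]⟩

@[simp] lemma yl_00 (b : R) : (yl b) 0 0 = 1 := rfl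
@[simp] lemma yl_01 (b : R) : (yl b) 0 1 = 0 := rfl
@[simp] lemma yl_10 (b : R) : (yl b) 1 0 = b := rfl
@[simp] lemma yl_11 (b : R) : (yl b) 1 1 = 1 := rfl

lemma wt_x (b : R) : wt * x b = yl (-b) * wt := by
  simp [ext_iff', mul_apply]

lemma x_yl_x (u : Rˣ) : x (u : R) * yl (-(u⁻¹ : Rˣ) : R) * x (u : R) = dg u * wt := by
  simp [ext_iff', mul_apply]

end SLTwo

namespace RootPair

open SLTwo

variable {R G : Type*} [CommRing R] [Group G] {D : RootPair R G}

open Classical in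
/-- The normal form, read in `G`, of a matrix over a local ring: the big cell if the lower left
entry is a unit, and the translate of the big cell by `w` otherwise. Over a local ring one of the
two lower entries is a unit, so the value `1` in the last case is never used. -/
noncomputable def normalForm (D : RootPair R G) (M : SL(2, R)) : G :=
  if h : IsUnit (M 1 0) then
    D.X (M 0 0 * (h.unit⁻¹ : Rˣ)) * D.W (-h.unit⁻¹) * D.X (M 1 1 * (h.unit⁻¹ : Rˣ))
  else if h' : IsUnit (M 1 1) then
    D.X (M 0 1 * (h'.unit⁻¹ : Rˣ)) * D.W (-h'.unit⁻¹) * D.X (-(M 1 0 * (h'.unit⁻¹ : Rˣ))) * D.w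
  else 1

lemma normalForm_of_isUnit {M : SL(2, R)} (c : Rˣ) (hc : M 1 0 = c) :
    D.normalForm M = D.X (M 0 0 * (c⁻¹ : Rˣ)) * D.W (-c⁻¹) * D.X (M 1 1 * (c⁻¹ : Rˣ)) := by
  have h : IsUnit (M 1 0) := ⟨c, hc.symm⟩
  have : h.unit = c := Units.ext hc
  rw [normalForm, dif_pos h, this]

lemma normalForm_of_not_isUnit {M : SL(2, R)} (hc : ¬ IsUnit (M 1 0)) (d : Rˣ) (hd : M 1 1 = d) :
    D.normalForm M =
      D.X (M 0 1 * (d⁻¹ : Rˣ)) * D.W (-d⁻¹) * D.X (-(M 1 0 * (d⁻¹ : Rˣ))) * D.w := by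
  have h : IsUnit (M 1 1) := ⟨d, hd.symm⟩
  have : h.unit = d := Units.ext hd
  rw [normalForm, dif_neg hc, dif_pos h, this]

lemma isUnit_of_not_isUnit [IsLocalRing R] (M : SL(2, R)) (hc : ¬ IsUnit (M 1 0)) :
    IsUnit (M 1 1) := by
  by_contra hd
  have h1 := det_eq M
  have h2 : M 0 0 * M 1 1 - M 0 1 * M 1 0 ∈ IsLocalRing.maximalIdeal R :=
    sub_mem (Ideal.mul_mem_left _ _ ((IsLocalRing.mem_maximalIdeal _).2 hd))
      (Ideal.mul_mem_left _ _ ((IsLocalRing.mem_maximalIdeal _).2 hc))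
  rw [h1] at h2
  exact (IsLocalRing.mem_maximalIdeal _).1 h2 isUnit_one

namespace IsSteinberg

variable (h : D.IsSteinberg) (H_mul : ∀ u v, D.H (u * v) = D.H u * D.H v)
include h H_mul

lemma normalForm_mul_wt [IsLocalRing R] (M : SL(2, R)) :
    D.normalForm (M * wt) = D.normalForm M * D.w := by
  have e1 : (M * wt : SL(2, R)) 1 0 = - M 1 1 := by simp [mul_apply]
  have e2 : (M * wt : SL(2, R)) 1 1 = M 1 0 := by simp [mul_apply]
  have e3 : (M * wt : SL(2, R)) 0 0 = - M 0 1 := by simp [mul_apply]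
  have e4 : (M * wt : SL(2, R)) 0 1 = M 0 0 := by simp [mul_apply]
  by_cases hd : IsUnit (M 1 1)
  · obtain ⟨d, hd⟩ := hd
    rw [normalForm_of_isUnit (-d) (by rw [e1, ← hd, Units.val_neg]), e2, e3]
    by_cases hc : IsUnit (M 1 0)
    · obtain ⟨c, hc⟩ := hc
      rw [normalForm_of_isUnit c hc.symm, ← hd, h.bruhat H_mul _ (M 0 1) c d
        (by rw [hc, hd, det_eq]), ← hc]
      congr 3
      · simp
      · simp
      · simp
    · rw [normalForm_of_not_isUnit hc d hd.symm]
      have h1 := h.W_mul_w_sq H_mul (-d⁻¹)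
      rw [neg_neg] at h1
      simp only [mul_assoc]
      rw [← h.w_sq_X, ← mul_assoc (D.W _), h1]
      simp
  · have hc : IsUnit (M 1 0) := by
      by_contra hc
      exact hd (isUnit_of_not_isUnit M hc)
    obtain ⟨c, hc⟩ := hc
    rw [normalForm_of_isUnit c hc.symm, normalForm_of_not_isUnit (by rwa [e1, IsUnit.neg_iff]) c
      (by rw [e2, hc]), e4, e1, neg_mul, neg_neg]

lemma normalForm_mul_x_one [IsLocalRing R] (M : SL(2, R)) :
    D.normalForm (M * x 1) = D.normalForm M * D.X 1 := by
  have e1 : (M * x 1 : SL(2, R)) 1 0 = M 1 0 := by simp [mul_apply]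
  have e2 : (M * x 1 : SL(2, R)) 1 1 = M 1 0 + M 1 1 := by simp [mul_apply]
  have e3 : (M * x 1 : SL(2, R)) 0 0 = M 0 0 := by simp [mul_apply]
  have e4 : (M * x 1 : SL(2, R)) 0 1 = M 0 0 + M 0 1 := by simp [mul_apply]
  by_cases hc : IsUnit (M 1 0)
  · obtain ⟨c, hc⟩ := hc
    rw [normalForm_of_isUnit c (e1.trans hc.symm), normalForm_of_isUnit c hc.symm, e3, e2, ← hc,
      mul_assoc _ (D.X _) (D.X 1), ← D.X_add]
    congr 2
    simp [add_mul, add_comm]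
  · obtain ⟨d, hd⟩ := isUnit_of_not_isUnit M hc
    have hd' : IsUnit (M 1 0 + M 1 1) := by
      rw [← e2]; exact isUnit_of_not_isUnit _ (by rwa [e1])
    obtain ⟨d', hd'⟩ := hd'
    rw [normalForm_of_not_isUnit (by rwa [e1]) d' (by rw [e2, hd']),
      normalForm_of_not_isUnit hc d hd.symm, e4, e1]
    have h1 := h.bruhat H_mul (M 0 1) (-(M 0 0 + M 0 1)) d (-d') (by
      rw [Units.val_neg, hd', hd]; linear_combination det_eq M)
    have i1 : ((d⁻¹ : Rˣ) : R) * d = 1 := by simp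
    have i2 : ((d'⁻¹ : Rˣ) : R) * d' = 1 := by simp
    -- moving `x(1)` across `w` produces a lower unipotent, which lies in the big cell
    have h2 : D.w * D.X 1 = D.X (-1) * D.w * D.X (-1) * D.w := by
      have := h.W_one
      rw [W] at this
      simp only [Units.val_one, inv_one] at this
      rw [w_X, mul_left_inj, ← this]
      simp only [X_neg]
      group
    rw [mul_assoc _ D.w, h2]
    simp only [← mul_assoc]
    rw [mul_left_inj, mul_assoc _ (D.X _) (D.X (-1)), ← D.X_add]
    have e5 : -(M 1 0 * ((d⁻¹ : Rˣ) : R)) + -1 = ((-d' : Rˣ) : R) * (d⁻¹ : Rˣ) := by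
      rw [Units.val_neg, hd', ← hd]; linear_combination i1
    rw [e5, h1, mul_assoc _ (D.X _) (D.X (-1)), ← D.X_add]
    congr 2
    · congr 1
      simp only [inv_neg, Units.val_neg]
      ring_nf
    · simp only [inv_neg, Units.val_neg]
      have : (d' : R) - d = M 1 0 := by rw [hd', hd]; ring
      rw [← this]
      linear_combination -i2

/-- Steinberg data with multiplicative torus elements define a homomorphism from `SL₂` of a local
ring. The normal form is equivariant under right multiplication by the two generators, hence
multiplicative. -/
theorem exists_hom [IsLocalRing R] (hgen : Subgroup.closure {(x 1 : SL(2, R)), wt} = ⊤) :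
    ∃ Φ : SL(2, R) →* G, Φ (x 1) = D.X 1 ∧ Φ wt = D.w := by
  have h1 : D.normalForm 1 = 1 := by
    obtain ⟨a1, a2, a3, a4⟩ := one_apply' (R := R)
    rw [normalForm_of_not_isUnit (by rw [a3]; exact not_isUnit_zero) 1 (by rw [a4]; rfl), a2, a3]
    simp [X_zero, W_neg, h.W_one]
  -- the elements by which right multiplication is compatible with the normal form
  let S : Subgroup SL(2, R) :=
    { carrier := {g | ∃ γ, ∀ M, D.normalForm (M * g) = D.normalForm M * γ}
      one_mem' := ⟨1, by simp⟩
      mul_mem' := by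
        rintro a b ⟨γ, hγ⟩ ⟨δ, hδ⟩
        exact ⟨γ * δ, fun M => by rw [← mul_assoc, hδ, hγ, mul_assoc]⟩
      inv_mem' := by
        rintro a ⟨γ, hγ⟩
        refine ⟨γ⁻¹, fun M => ?_⟩
        rw [eq_mul_inv_iff_mul_eq, ← hγ, inv_mul_cancel_right] }
  have hS : S = ⊤ := by
    rw [eq_top_iff, ← hgen, Subgroup.closure_le]
    rintro g (rfl | rfl)
    · exact ⟨_, h.normalForm_mul_x_one H_mul⟩
    · exact ⟨_, h.normalForm_mul_wt H_mul⟩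
  have key : ∀ M N, D.normalForm (M * N) = D.normalForm M * D.normalForm N := by
    intro M N
    have : N ∈ S := by rw [hS]; trivial
    obtain ⟨γ, hγ⟩ := this
    have := hγ 1
    rw [one_mul, h1, one_mul] at this
    rw [hγ, this]
  refine ⟨⟨⟨D.normalForm, h1⟩, key⟩, ?_, ?_⟩
  · have := h.normalForm_mul_x_one H_mul 1
    rwa [one_mul, h1, one_mul] at this
  · have := h.normalForm_mul_wt H_mul 1
    rwa [one_mul, h1, one_mul] at this

end IsSteinberg
end RootPair

/-! ### Reduction of `SL₂(ℤ)` modulo integers -/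

namespace SLTwo

/-- A residue class modulo `N` contains an integer prime to `c` if it is prime to `gcd(c, N)`. -/
lemma exists_isCoprime_add_mul (N : ℕ) (c d : ℤ) (hc : c ≠ 0) (h : IsCoprime d (Int.gcd c N)) :
    ∃ j : ℤ, IsCoprime c (d + j * N) := by
  set g := Int.gcd c N with hg
  have hgc : g ∣ c.natAbs := Int.natCast_dvd.1 (Int.gcd_dvd_left ..)
  have : NeZero c.natAbs := ⟨by simpa using hc⟩
  have hu : IsUnit (d : ZMod g) := by
    obtain ⟨s, t, hst⟩ := h
    have := congrArg (Int.cast : ℤ → ZMod g) hst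
    push_cast at this
    rw [ZMod.natCast_self, mul_zero, add_zero] at this
    exact IsUnit.of_mul_eq_one_right _ this
  obtain ⟨v, hv⟩ := ZMod.unitsMap_surjective hgc hu.unit
  have hv' : ((v : ZMod c.natAbs).val : ZMod g) = d := by
    have := congrArg Units.val hv
    rw [ZMod.unitsMap_def] at this
    simpa [ZMod.natCast_val] using this
  have h1 : (g : ℤ) ∣ ((v : ZMod c.natAbs).val : ℤ) - d := by
    rw [← ZMod.intCast_eq_intCast_iff_dvd_sub]
    push_cast
    exact hv'.symm
  obtain ⟨e, he⟩ := h1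
  have h2 := Int.gcd_eq_gcd_ab c N
  rw [← hg] at h2
  refine ⟨Int.gcdB c N * e, ?_⟩
  have h3 : d + Int.gcdB c N * e * N =
      ((v : ZMod c.natAbs).val : ℤ) + c * (-(Int.gcdA c N * e)) := by
    linear_combination (-1 : ℤ) * he - e * h2
  rw [h3, IsCoprime.add_mul_left_right_iff]
  have := (ZMod.val_coe_unit_coprime v).symm
  rw [Int.isCoprime_iff_gcd_eq_one, Int.gcd_def, Int.natAbs_natCast]
  exact this

/-- An integer matrix whose determinant is `1` modulo `N` is congruent to an element of
`SL(2, ℤ)`. -/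
lemma exists_lift (N : ℕ) (hN : 0 < N) (a b c d : ℤ) (h : a * d - b * c ≡ 1 [ZMOD N]) :
    ∃ γ : SL(2, ℤ), (γ 0 0 : ZMod N) = a ∧ (γ 0 1 : ZMod N) = b ∧ (γ 1 0 : ZMod N) = c ∧
      (γ 1 1 : ZMod N) = d := by
  -- the lower left entry has to be nonzero for the choice of the lower right one
  obtain ⟨c₁, hc₁, hcc⟩ : ∃ c₁ : ℤ, c₁ ≠ 0 ∧ (c₁ : ZMod N) = c := by
    by_cases hc : c = 0
    · exact ⟨N, by exact_mod_cast hN.ne', by simp [hc]⟩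
    · exact ⟨c, hc, rfl⟩
  have hZ : (a : ZMod N) * d - b * c = 1 := by
    have := (ZMod.intCast_eq_intCast_iff _ _ _).2 h
    exact_mod_cast this
  have hcop : IsCoprime d (Int.gcd c₁ N) := by
    have h1 : ((Int.gcd c₁ N : ℕ) : ℤ) ∣ a * d - b * c₁ - 1 := by
      refine (Int.gcd_dvd_right (a := c₁) (b := N)).trans ?_
      rw [← ZMod.intCast_zmod_eq_zero_iff_dvd]
      push_cast
      rw [hcc, hZ, sub_self]
    obtain ⟨e, he⟩ := h1
    obtain ⟨f, hf⟩ := Int.gcd_dvd_left (a := c₁) (b := N)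
    refine ⟨a, -(b * f) - e, ?_⟩
    linear_combination he + b * hf
  obtain ⟨j, hj⟩ := exists_isCoprime_add_mul N c₁ d hc₁ hcop
  obtain ⟨γ, h0, h1⟩ := hj.exists_SL2_row 1
  have hdet := congrArg (Int.cast : ℤ → ZMod N) (det_eq γ)
  push_cast at hdet
  rw [h0, h1] at hdet
  push_cast at hdet
  rw [hcc, ZMod.natCast_self, mul_zero, add_zero] at hdet
  -- the lower row is right; a power of `T` corrects the upper row
  refine ⟨ModularGroup.T ^ (b * γ 0 0 - a * γ 0 1) * γ, ?_⟩
  have hT := ModularGroup.coe_T_zpow (b * γ 0 0 - a * γ 0 1)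
  simp only [mul_apply, hT, Matrix.of_apply, Matrix.cons_val', Matrix.cons_val_zero,
    Matrix.cons_val_one, Matrix.empty_val', Matrix.cons_val_fin_one, h0, h1]
  push_cast
  rw [hcc, ZMod.natCast_self]
  refine ⟨?_, ?_, ?_, ?_⟩
  · linear_combination (a : ZMod N) * hdet - ((γ 0 0 : ℤ) : ZMod N) * hZ
  · linear_combination (b : ZMod N) * hdet - ((γ 0 1 : ℤ) : ZMod N) * hZ
  · ring
  · ring

/-- Reduction `SL₂(ℤ) → SL₂(ℤ/N)`. -/
abbrev red (N : ℕ) : SL(2, ℤ) →* SL(2, ZMod N) :=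
  Matrix.SpecialLinearGroup.map (Int.castRingHom (ZMod N))

lemma red_surjective (N : ℕ) (hN : 0 < N) : Function.Surjective (red N) := by
  intro M
  have : NeZero N := ⟨hN.ne'⟩
  obtain ⟨γ, h1, h2, h3, h4⟩ := exists_lift N hN (M 0 0).val (M 0 1).val (M 1 0).val (M 1 1).val
    (by
      rw [← ZMod.intCast_eq_intCast_iff]
      push_cast
      simp only [ZMod.natCast_zmod_val]
      exact det_eq M)
  refine ⟨γ, ext_iff'.2 ⟨?_, ?_, ?_, ?_⟩⟩
  · simpa using h1
  · simpa using h2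
  · simpa using h3
  · simpa using h4

lemma red_apply (N : ℕ) (γ : SL(2, ℤ)) (i j : Fin 2) : red N γ i j = (γ i j : ZMod N) := by
  simp

lemma red_T (N : ℕ) : red N ModularGroup.T = x 1 := by
  rw [ext_iff']
  simp only [red_apply]
  simp [ModularGroup.T]

/-- The Weyl element used here is the inverse of Mathlib's `S`. -/
lemma red_S (N : ℕ) : red N ModularGroup.S = wt⁻¹ := by
  rw [eq_inv_iff_mul_eq_one, ext_iff']
  simp only [mul_apply, red_apply]
  simp [ModularGroup.S]

lemma closure_x_wt (N : ℕ) (hN : 0 < N) :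
    Subgroup.closure {(x 1 : SL(2, ZMod N)), wt} = ⊤ := by
  have h1 := congrArg (Subgroup.map (red N)) _root_.SpecialLinearGroup.SL2Z_generators
  rw [Subgroup.map_top_of_surjective _ (red_surjective N hN), MonoidHom.map_closure] at h1
  rw [eq_top_iff, ← h1, Subgroup.closure_le]
  rintro _ ⟨g, rfl | rfl, rfl⟩
  · rw [red_S]
    exact inv_mem (Subgroup.subset_closure (by simp))
  · rw [red_T]
    exact Subgroup.subset_closure (by simp)

lemma mem_Gamma_iff_red {N : ℕ} {γ : SL(2, ℤ)} : γ ∈ CongruenceSubgroup.Gamma N ↔ red N γ = 1 :=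
  CongruenceSubgroup.Gamma_mem'

/-- The Chinese remainder theorem in the form `Γ(gcd(m, n)) ⊆ Γ(m) Γ(n)`. -/
lemma exists_Gamma_mul {m n : ℕ} (hm : 0 < m) (hn : 0 < n) {γ : SL(2, ℤ)}
    (hγ : γ ∈ CongruenceSubgroup.Gamma (Nat.gcd m n)) :
    ∃ δ : SL(2, ℤ), red m δ = red m γ ∧ red n δ = 1 := by
  have crt : ∀ s t : ℤ, (s : ZMod (Nat.gcd m n)) = t →
      ∃ z : ℤ, (z : ZMod m) = s ∧ (z : ZMod n) = t := by
    intro s t hst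
    rw [ZMod.intCast_eq_intCast_iff_dvd_sub] at hst
    obtain ⟨e, he⟩ := hst
    have := Nat.gcd_eq_gcd_ab m n
    refine ⟨s + m * (Nat.gcdA m n * e), by simp, ?_⟩
    have h2 : s + m * (Nat.gcdA m n * e) = t - n * (Nat.gcdB m n * e) := by
      linear_combination (-1 : ℤ) * he - e * this
    rw [h2]
    simp
  rw [CongruenceSubgroup.Gamma_mem] at hγ
  obtain ⟨g1, g2, g3, g4⟩ := hγ
  obtain ⟨a, a1, a2⟩ := crt (γ 0 0) 1 (by simpa using g1)
  obtain ⟨b, b1, b2⟩ := crt (γ 0 1) 0 (by simpa using g2)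
  obtain ⟨c, c1, c2⟩ := crt (γ 1 0) 0 (by simpa using g3)
  obtain ⟨d, d1, d2⟩ := crt (γ 1 1) 1 (by simpa using g4)
  obtain ⟨δ, e1, e2, e3, e4⟩ := exists_lift (Nat.lcm m n) (Nat.lcm_pos hm hn) a b c d (by
    have h1 : (m : ℤ) ∣ a * d - b * c - 1 := by
      rw [← ZMod.intCast_zmod_eq_zero_iff_dvd]
      have := congrArg (Int.cast : ℤ → ZMod m) (det_eq γ)
      push_cast at this ⊢
      rw [a1, b1, c1, d1, this, sub_self]
    have h2 : (n : ℤ) ∣ a * d - b * c - 1 := by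
      rw [← ZMod.intCast_zmod_eq_zero_iff_dvd]
      push_cast
      rw [a2, b2, c2, d2]
      simp
    have h3 : ((Nat.lcm m n : ℕ) : ℤ) ∣ a * d - b * c - 1 := by
      have := Int.coe_lcm_dvd h1 h2
      simpa using this
    exact (Int.modEq_iff_dvd.2 h3).symm)
  have down : ∀ (k : ℕ), k ∣ Nat.lcm m n → ∀ s t : ℤ, (s : ZMod (Nat.lcm m n)) = t →
      (s : ZMod k) = t := by
    intro k hk s t hst
    rw [ZMod.intCast_eq_intCast_iff_dvd_sub] at hst ⊢
    exact (Int.natCast_dvd_natCast.2 hk).trans hst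
  refine ⟨δ, ext_iff'.2 ?_, ext_iff'.2 ?_⟩
  · have := down m (Nat.dvd_lcm_left m n)
    refine ⟨?_, ?_, ?_, ?_⟩
    · simpa using (this _ _ e1).trans a1
    · simpa using (this _ _ e2).trans b1
    · simpa using (this _ _ e3).trans c1
    · simpa using (this _ _ e4).trans d1
  · have := down n (Nat.dvd_lcm_right m n)
    refine ⟨?_, ?_, ?_, ?_⟩
    · simpa using (this _ _ e1).trans a2
    · simpa using (this _ _ e2).trans b2
    · simpa using (this _ _ e3).trans c2
    · simpa using (this _ _ e4).trans d2

end SLTwo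

lemma ZMod.isUnit_prime_pow_iff {p b : ℕ} (hp : p.Prime) (hb : b ≠ 0) (a : ℤ) :
    IsUnit (a : ZMod (p ^ b)) ↔ ¬ (p : ℤ) ∣ a := by
  rw [ZMod.coe_int_isUnit_iff_isCoprime]
  push_cast
  rw [IsCoprime.pow_left_iff (Nat.pos_of_ne_zero hb),
    (Nat.prime_iff_prime_int.1 hp).coprime_iff_not_dvd]

lemma ZMod.isLocalRing_prime_pow {p b : ℕ} (hp : p.Prime) (hb : b ≠ 0) :
    IsLocalRing (ZMod (p ^ b)) := by
  have : Nontrivial (ZMod (p ^ b)) :=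
    ZMod.nontrivial_iff.2 (Nat.one_lt_pow hb hp.one_lt).ne'
  refine IsLocalRing.of_isUnit_or_isUnit_one_sub_self fun a => ?_
  obtain ⟨a, rfl⟩ := ZMod.intCast_surjective a
  have h1 : (1 : ZMod (p ^ b)) - a = ((1 - a : ℤ) : ZMod (p ^ b)) := by push_cast; rfl
  rw [h1, ZMod.isUnit_prime_pow_iff hp hb, ZMod.isUnit_prime_pow_iff hp hb]
  by_contra! hcon
  have := dvd_add hcon.1 hcon.2
  rw [add_sub_cancel] at this
  exact (Nat.prime_iff_prime_int.1 hp).not_dvd_one this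

/-! ### Relations between torus elements -/

namespace RootPair

variable {R G : Type*} [CommRing R] [Group G] {D : RootPair R G}

namespace IsSteinberg

variable (h : D.IsSteinberg)
include h

lemma H_X_inv (u : Rˣ) (b : R) :
    (D.H u)⁻¹ * D.X b = D.X ((u⁻¹ : Rˣ) * (u⁻¹ : Rˣ) * b) * (D.H u)⁻¹ := by
  rw [inv_mul_eq_iff_eq_mul, ← mul_assoc, h.H_X, eq_mul_inv_iff_mul_eq]
  congr 2
  have : ((u⁻¹ : Rˣ) : R) * u = 1 := by simp
  linear_combination (-(1 + ((u⁻¹ : Rˣ) : R) * u) * b) * this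

lemma H_Y_inv (u : Rˣ) (b : R) : (D.H u)⁻¹ * D.Y b = D.Y (u * u * b) * (D.H u)⁻¹ := by
  rw [inv_mul_eq_iff_eq_mul, ← mul_assoc, h.H_Y, eq_mul_inv_iff_mul_eq]
  congr 2
  have : ((u⁻¹ : Rˣ) : R) * u = 1 := by simp
  linear_combination (-(1 + ((u⁻¹ : Rˣ) : R) * u) * b) * this

lemma w_X_w_eq_H (e : Rˣ) : D.w * D.X e * D.w =
    D.X (-(e⁻¹ : Rˣ)) * D.H e⁻¹ * D.w * (D.w * D.w) * D.X (-(e⁻¹ : Rˣ)) := by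
  rw [h.w_X_w, W_eq]
  group

/-- The Steinberg relation `{u, 1 - u} = 1` in terms of torus elements. It comes from comparing the
Bruhat decompositions of `w x(1) w` and of `(w x(u) w) w⁻² (w x(v) w)`. -/
lemma torus_relation_of_add_eq_one (u v : Rˣ) (huv : (u : R) + v = 1) :
    D.H u⁻¹ * D.H v * D.H (-(u * v⁻¹)) = D.H (-1) := by
  have iu : ((u⁻¹ : Rˣ) : R) * u = 1 := by simp
  have iv : ((v⁻¹ : Rˣ) : R) * v = 1 := by simp
  have hz := h.w_sq_X
  have hzH := h.w_sq_H
  have h1 : D.w * D.X 1 * D.w = (D.w * D.X u * D.w) * (D.w * D.w)⁻¹ * (D.w * D.X v * D.w) := by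
    rw [← huv, D.X_add]; group
  have h2 := h.w_X_w_eq_H 1
  simp only [Units.val_one, inv_one, h.H_one, mul_one] at h2
  rw [h2, h.w_X_w_eq_H u, h.w_X_w_eq_H v] at h1
  have h3 : D.w * (D.w * D.w) * D.X (-(u⁻¹ : Rˣ)) * (D.w * D.w)⁻¹ * D.X (-(v⁻¹ : Rˣ)) * D.H v⁻¹ *
      D.w = D.H v * (D.w * D.X ((-(v * u⁻¹) : Rˣ) : R) * D.w) := by
    have e1 : D.w * (D.w * D.w) * D.X (-(u⁻¹ : Rˣ)) * (D.w * D.w)⁻¹ =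
        D.w * D.X (-(u⁻¹ : Rˣ)) := by
      rw [mul_inv_eq_iff_eq_mul, mul_assoc, hz, mul_assoc]
    rw [e1, mul_assoc D.w, ← D.X_add]
    have e2 : D.X (-((u⁻¹ : Rˣ) : R) + -(v⁻¹ : Rˣ)) * D.H v⁻¹ =
        D.H v⁻¹ * D.X ((-(v * u⁻¹) : Rˣ) : R) := by
      rw [h.H_X]
      congr 2
      push_cast
      linear_combination (-((u⁻¹ : Rˣ) : R) * (v⁻¹ : Rˣ)) * huv + ((v⁻¹ : Rˣ) : R) * iu +
        (((u⁻¹ : Rˣ) : R) + (u⁻¹ : Rˣ) * (v⁻¹ : Rˣ)) * iv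
    rw [mul_assoc D.w, e2, ← mul_assoc D.w, h.w_H, inv_inv]
    group
  have e5 : (((-(v * u⁻¹))⁻¹ : Rˣ)) = -(u * v⁻¹) := by simp
  rw [h.w_X_w_eq_H, e5] at h3
  have e6 : D.H u⁻¹ * D.H v * D.X (-((-(u * v⁻¹) : Rˣ) : R)) =
      D.X (v * (u⁻¹ : Rˣ)) * (D.H u⁻¹ * D.H v) := by
    rw [mul_assoc, h.H_X, ← mul_assoc, h.H_X, mul_assoc]
    congr 2
    push_cast
    linear_combination (((u⁻¹ : Rˣ) : R) * v) * ((u⁻¹ : Rˣ) * u * iv + iu)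
  have e7 : -((u⁻¹ : Rˣ) : R) + v * (u⁻¹ : Rˣ) = -1 := by
    linear_combination ((u⁻¹ : Rˣ) : R) * huv - iu
  have e8 : -((-(u * v⁻¹) : Rˣ) : R) + -(v⁻¹ : Rˣ) = -1 := by
    push_cast
    linear_combination ((v⁻¹ : Rˣ) : R) * huv - iv
  have h4 : D.X (-1) * D.w * (D.w * D.w) * D.X (-1) =
      D.X (-1) * (D.H u⁻¹ * D.H v * D.H (-(u * v⁻¹))) * D.w * (D.w * D.w) * (D.w * D.w) *
        D.X (-1) := by
    calc _ = D.X (-(u⁻¹ : Rˣ)) * D.H u⁻¹ * (D.w * (D.w * D.w) * D.X (-(u⁻¹ : Rˣ)) *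
          (D.w * D.w)⁻¹ * D.X (-(v⁻¹ : Rˣ)) * D.H v⁻¹ * D.w) * (D.w * D.w) *
          D.X (-(v⁻¹ : Rˣ)) := by rw [h1]; group
      _ = D.X (-(u⁻¹ : Rˣ)) * (D.H u⁻¹ * D.H v * D.X (-((-(u * v⁻¹) : Rˣ) : R))) *
          D.H (-(u * v⁻¹)) * D.w * (D.w * D.w) * (D.X (-((-(u * v⁻¹) : Rˣ) : R)) *
          (D.w * D.w)) * D.X (-(v⁻¹ : Rˣ)) := by rw [h3]; group
      _ = (D.X (-(u⁻¹ : Rˣ)) * D.X (v * (u⁻¹ : Rˣ))) * (D.H u⁻¹ * D.H v *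
          D.H (-(u * v⁻¹))) * D.w * (D.w * D.w) * (D.w * D.w) *
          (D.X (-((-(u * v⁻¹) : Rˣ) : R)) * D.X (-(v⁻¹ : Rˣ))) := by rw [e6, ← hz]; group
      _ = _ := by rw [← D.X_add, ← D.X_add, e7, e8]
  rw [h.H_neg_one, eq_inv_iff_mul_eq_one]
  have h5 : D.w * (D.w * D.w) = D.H u⁻¹ * D.H v * D.H (-(u * v⁻¹)) * D.w * (D.w * D.w) *
      (D.w * D.w) := by
    refine mul_right_cancel (b := D.X (-1)) (mul_left_cancel (a := D.X (-1)) ?_)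
    simpa only [mul_assoc] using h4
  rw [← mul_left_inj (D.w * (D.w * D.w)), one_mul]
  nth_rewrite 2 [h5]
  group

/-- The exchange relation between the two unipotent groups, when `1 + a b` is a unit. -/
lemma X_mul_Y (a : R) (b v : Rˣ) (hv : (v : R) = 1 + a * b) :
    D.X a * D.Y b = D.Y (b * (v⁻¹ : Rˣ)) * (D.H (-b) * (D.H (-(b * v⁻¹)))⁻¹) *
      D.X (a * (v⁻¹ : Rˣ)) := by
  have ib : ((b⁻¹ : Rˣ) : R) * b = 1 := by simp
  have iv : ((v⁻¹ : Rˣ) : R) * v = 1 := by simp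
  have yform : ∀ c : Rˣ, D.Y c = D.X (c⁻¹ : Rˣ) * D.W (-c⁻¹) * D.X (c⁻¹ : Rˣ) := by
    intro c
    have : D.W (-c⁻¹) = D.X (-(c⁻¹ : Rˣ)) * D.Y c * D.X (-(c⁻¹ : Rˣ)) := by
      rw [W]; simp
    rw [this, X_neg]; group
  have e1 : a + (b⁻¹ : Rˣ) = v * (b⁻¹ : Rˣ) := by
    linear_combination (-((b⁻¹ : Rˣ) : R)) * hv - a * ib
  have e2 : ((b * v⁻¹)⁻¹ : Rˣ) = v * b⁻¹ := by simp
  have e3 : D.X (v * (b⁻¹ : Rˣ)) * (D.H (-b) * (D.H (-(b * v⁻¹)))⁻¹) =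
      (D.H (-b) * (D.H (-(b * v⁻¹)))⁻¹) * D.X ((v⁻¹ : Rˣ) * (b⁻¹ : Rˣ)) := by
    rw [mul_assoc, h.H_X_inv, ← mul_assoc, ← mul_assoc, h.H_X]
    congr 3
    simp only [inv_neg, mul_inv, inv_inv, Units.val_neg, Units.val_mul]
    linear_combination (-(v : R) * (b⁻¹ : Rˣ) * ((b⁻¹ : Rˣ) * b) ^ 2) * iv -
      (v : R) * (b⁻¹ : Rˣ) * ((b⁻¹ : Rˣ) * b + 1) * ib
  have e4 : ((v⁻¹ : Rˣ) : R) * (b⁻¹ : Rˣ) + a * (v⁻¹ : Rˣ) = (b⁻¹ : Rˣ) := by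
    linear_combination ((v⁻¹ : Rˣ) : R) * e1 + ((b⁻¹ : Rˣ) : R) * iv
  have e5 : D.W (-(v * b⁻¹)) * (D.H (-b) * (D.H (-(b * v⁻¹)))⁻¹) = D.W (-b⁻¹) := by
    have h1 := h.w_H (-b)
    have h2 := h.w_H (-(b * v⁻¹))
    rw [inv_neg] at h1
    rw [inv_neg, e2] at h2
    rw [W_eq, W_eq, ← mul_assoc, mul_inv_eq_iff_eq_mul, mul_assoc, h1, mul_assoc, h2, ← mul_assoc,
      ← mul_assoc, h.H_comm]
  have h1 := yform (b * v⁻¹)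
  rw [e2] at h1
  push_cast at h1
  rw [yform b, h1, ← mul_assoc, ← mul_assoc, ← D.X_add, e1, mul_assoc _ (D.X (v * _)), e3,
    mul_assoc, mul_assoc, mul_assoc _ (D.X _) (D.X _), ← D.X_add, e4, ← e5]
  group

/-- The exchange relation for `x(a) y(u₁ + u₂)`, obtained by moving `y(u₁)` and `y(u₂)` one after
the other to the left. -/
lemma X_mul_Y_add (a : R) (u₁ u₂ v₁ v₂ : Rˣ) (hv₁ : (v₁ : R) = 1 + a * u₁)
    (hv₂ : (v₁ * v₂ : R) = 1 + a * (u₁ + u₂)) :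
    D.X a * D.Y (u₁ + u₂) = D.Y ((u₁ + u₂) * ((v₁ * v₂)⁻¹ : Rˣ)) *
      (D.H (-u₁) * (D.H (-(u₁ * v₁⁻¹)))⁻¹ * (D.H (-u₂) * (D.H (-(u₂ * v₂⁻¹)))⁻¹)) *
      D.X (a * ((v₁ * v₂)⁻¹ : Rˣ)) := by
  have i1 : ((v₁⁻¹ : Rˣ) : R) * v₁ = 1 := by simp
  have i2 : ((v₂⁻¹ : Rˣ) : R) * v₂ = 1 := by simp
  have i3 : ((u₁⁻¹ : Rˣ) : R) * u₁ = 1 := by simp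
  have e1 : (v₂ : R) = 1 + a * (v₁⁻¹ : Rˣ) * u₂ := by
    linear_combination ((v₁⁻¹ : Rˣ) : R) * (hv₂ - hv₁) - (v₂ - 1 : R) * i1
  have e2 : D.H (-u₁) * (D.H (-(u₁ * v₁⁻¹)))⁻¹ * D.Y (u₂ * (v₂⁻¹ : Rˣ)) =
      D.Y ((v₁⁻¹ : Rˣ) * (v₁⁻¹ : Rˣ) * (u₂ * (v₂⁻¹ : Rˣ))) *
        (D.H (-u₁) * (D.H (-(u₁ * v₁⁻¹)))⁻¹) := by
    rw [mul_assoc, h.H_Y_inv, ← mul_assoc (D.H _), h.H_Y, mul_assoc]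
    congr 2
    simp only [inv_neg, Units.val_neg, Units.val_mul]
    linear_combination (((v₁⁻¹ : Rˣ) : R) * ((v₁⁻¹ : Rˣ) : R) * ((u₂ : R) * ((v₂⁻¹ : Rˣ) : R)) *
      (((u₁⁻¹ : Rˣ) : R) * (u₁ : R) + 1)) * i3
  have e3 : (u₁ : R) * (v₁⁻¹ : Rˣ) + (v₁⁻¹ : Rˣ) * (v₁⁻¹ : Rˣ) * (u₂ * (v₂⁻¹ : Rˣ)) =
      (u₁ + u₂) * ((v₁⁻¹ : Rˣ) * (v₂⁻¹ : Rˣ)) := by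
    linear_combination (-(u₁ : R) * (v₁⁻¹ : Rˣ)) * i2 +
      ((v₁⁻¹ : Rˣ) * (v₂⁻¹ : Rˣ) * u₂ : R) * i1 + ((v₁⁻¹ : Rˣ) * (v₂⁻¹ : Rˣ) * u₁ : R) * e1 -
      ((v₁⁻¹ : Rˣ) * (v₁⁻¹ : Rˣ) * (v₂⁻¹ : Rˣ) * u₂ : R) * hv₁
  have e4 : (((v₁ * v₂)⁻¹ : Rˣ) : R) = (v₁⁻¹ : Rˣ) * (v₂⁻¹ : Rˣ) := by simp [mul_comm]
  calc _ = D.X a * D.Y (u₁ : R) * D.Y (u₂ : R) := by rw [Y_add, mul_assoc]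
    _ = D.Y (u₁ * (v₁⁻¹ : Rˣ)) * (D.H (-u₁) * (D.H (-(u₁ * v₁⁻¹)))⁻¹) *
        (D.X (a * (v₁⁻¹ : Rˣ)) * D.Y (u₂ : R)) := by rw [h.X_mul_Y a u₁ v₁ hv₁]; group
    _ = D.Y (u₁ * (v₁⁻¹ : Rˣ)) * (D.H (-u₁) * (D.H (-(u₁ * v₁⁻¹)))⁻¹ *
        D.Y (u₂ * (v₂⁻¹ : Rˣ))) * (D.H (-u₂) * (D.H (-(u₂ * v₂⁻¹)))⁻¹) *
        D.X (a * (v₁⁻¹ : Rˣ) * (v₂⁻¹ : Rˣ)) := by rw [h.X_mul_Y _ u₂ v₂ e1]; group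
    _ = _ := by rw [e2, e4, ← e3, Y_add, mul_assoc a]; group

/-- Expanding `x(a) y(b)` along two decompositions `b = u₁ + u₂ = u₃ + u₄` into units gives a
relation between torus elements. -/
lemma torus_relation_of_add_eq_add (a : R) (u₁ u₂ u₃ u₄ v₁ v₂ v₃ v₄ : Rˣ)
    (hu : (u₁ : R) + u₂ = u₃ + u₄) (hv₁ : (v₁ : R) = 1 + a * u₁)
    (hv₂ : (v₁ * v₂ : R) = 1 + a * (u₁ + u₂)) (hv₃ : (v₃ : R) = 1 + a * u₃)
    (hv₄ : v₃ * v₄ = v₁ * v₂) :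
    D.H (-u₁) * (D.H (-(u₁ * v₁⁻¹)))⁻¹ * (D.H (-u₂) * (D.H (-(u₂ * v₂⁻¹)))⁻¹) =
      D.H (-u₃) * (D.H (-(u₃ * v₃⁻¹)))⁻¹ * (D.H (-u₄) * (D.H (-(u₄ * v₄⁻¹)))⁻¹) := by
  have h1 := h.X_mul_Y_add a u₁ u₂ v₁ v₂ hv₁ hv₂
  have h2 := h.X_mul_Y_add a u₃ u₄ v₃ v₄ hv₃ (by
    rw [← hu, ← hv₂]; exact_mod_cast congrArg Units.val hv₄)
  rw [← hu, hv₄, h1] at h2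
  simpa only [mul_left_inj, mul_right_inj] using h2

end IsSteinberg
end RootPair

/-! ### Functions on unit groups with the formal properties of the torus elements -/

/-- If `-1` and `f` generate the units, then every unit is `±1` or `±f` up to squares. -/
lemma Units.exists_sq_mul_of_closure {R : Type*} [CommRing R] {f : Rˣ}
    (hgen : Subgroup.closure {-1, f} = ⊤) (u : Rˣ) :
    ∃ s : Rˣ, u = s * s * 1 ∨ u = s * s * (-1) ∨ u = s * s * f ∨ u = s * s * (-f) := by
  have hu : u ∈ Subgroup.closure {-1, f} := by rw [hgen]; trivial
  obtain ⟨i, j, rfl⟩ := Subgroup.mem_closure_pair.1 hu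
  have hi : ((-1 : Rˣ) ^ i = 1) ∨ ((-1 : Rˣ) ^ i = -1) := by
    rcases Int.even_or_odd i with hi | hi
    · exact Or.inl hi.neg_one_zpow
    · exact Or.inr hi.neg_one_zpow
  obtain ⟨k, rfl | rfl⟩ := Int.even_or_odd' j
  · refine ⟨f ^ k, ?_⟩
    have e : f ^ (2 * k) = f ^ k * f ^ k := by rw [two_mul, zpow_add]
    rw [e]
    rcases hi with hi | hi <;> rw [hi] <;> simp
  · refine ⟨f ^ k, ?_⟩
    have e : f ^ (2 * k + 1) = f ^ k * f ^ k * f := by rw [zpow_add_one, two_mul, zpow_add]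
    rw [e]
    rcases hi with hi | hi <;> rw [hi] <;> simp

/-- A function from the units of a ring to an abelian group with the formal properties shared by
the torus elements `h(u)` of a Steinberg pair. -/
structure IsTorusFunction {R A : Type*} [CommRing R] [AddCommGroup A] (η : Rˣ → A) : Prop where
  sq_mul : ∀ u v, η (u * u * v) = η (u * u) + η v
  add_neg : ∀ u, η u + η (-u) = η (u * u) + η (-1)

namespace IsTorusFunction

variable {R A : Type*} [CommRing R] [AddCommGroup A] {η : Rˣ → A} (h : IsTorusFunction η)
include h

lemma map_one : η 1 = 0 := by
  have := h.sq_mul 1 1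
  simpa using this

lemma sq_mul_sq (u v : Rˣ) : η ((u * v) * (u * v)) = η (u * u) + η (v * v) := by
  rw [← h.sq_mul]; congr 1; rw [mul_mul_mul_comm]

lemma sq_inv (u : Rˣ) : η (u⁻¹ * u⁻¹) = -η (u * u) := by
  rw [eq_neg_iff_add_eq_zero, ← h.sq_mul_sq]; simp [h.map_one]

/-- The Steinberg relation for `u, v` gives multiplicativity on this pair. -/
lemma add_of_relation {u v : Rˣ} (huv : η u⁻¹ + η v + η (-(u * v⁻¹)) = η (-1)) :
    η (u * v) = η u + η v := by
  have e1 : η u⁻¹ = η (u⁻¹ * u⁻¹) + η u := by rw [← h.sq_mul]; simp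
  have e2 : η (-(u * v⁻¹)) = η (v⁻¹ * v⁻¹) + η (-(u * v)) := by
    rw [← h.sq_mul]; congr 1; simp [mul_comm]
  have e3 := h.add_neg (u * v)
  have e4 := h.sq_mul_sq u v
  have e5 := h.sq_inv u
  have e6 := h.sq_inv v
  rw [e1, e2, e5, e6] at huv
  rw [e4] at e3
  linear_combination (norm := module) e3 - huv

/-- Multiplicativity when the nonsquare units form a single square class containing a pair
`u, v` on which `η` is multiplicative. -/
lemma map_mul_of_nonsquare {u₀ v₀ : Rˣ} (hu₀ : ¬ IsSquare u₀) (hv₀ : ¬ IsSquare v₀)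
    (h₀ : η (u₀ * v₀) = η u₀ + η v₀)
    (hns : ∀ u v : Rˣ, ¬ IsSquare u → ¬ IsSquare v → IsSquare (u * v⁻¹)) (u v : Rˣ) :
    η (u * v) = η u + η v := by
  by_cases hu : IsSquare u
  · obtain ⟨s, rfl⟩ := hu
    exact h.sq_mul s v
  by_cases hv : IsSquare v
  · obtain ⟨s, rfl⟩ := hv
    rw [mul_comm, h.sq_mul, add_comm]
  obtain ⟨s, hs⟩ := hns u u₀ hu hu₀
  obtain ⟨t, ht⟩ := hns v v₀ hv hv₀
  have e1 : u = s * s * u₀ := by rw [← hs]; group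
  have e2 : v = t * t * v₀ := by rw [← ht]; group
  have e3 : u * v = (s * t) * (s * t) * (u₀ * v₀) := by
    rw [e1, e2]; simp only [mul_comm, mul_left_comm]
  rw [e3, h.sq_mul, h.sq_mul_sq, h₀, e1, e2, h.sq_mul, h.sq_mul]
  abel

variable {f t s r th : Rˣ}

/-- For `f = 5` and `th = 3` in the units modulo a power of two, the hypothesis `rel` is the
relation obtained by expanding `x(4) y(2)` along `2 = 1 + 1 = 3 + (-1)`; the unit `13` is written
`f s²`. -/
lemma map_neg_of_relation (hth : th = -(f * t * t))
    (rel : η (-1) - η (-f⁻¹) + (η (-1) - η (-(f * th⁻¹ * th⁻¹))) =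
      η (-th) - η (-(th * (f * s * s)⁻¹)) + (η 1 - η (f * s * s * th⁻¹ * th⁻¹))) :
    η (-f) = η (-1) + η f := by
  have e1 : η (-f⁻¹) = -η (f * f) + η (-f) := by
    rw [← h.sq_inv, ← h.sq_mul]; simp
  have e2 : η (-(f * th⁻¹ * th⁻¹)) = -η (th * th) + η (-f) := by
    rw [← h.sq_inv, ← h.sq_mul]; congr 1; simp [mul_comm, mul_left_comm]
  have e3 : η (-th) = η (t * t) + η f := by
    rw [hth, ← h.sq_mul]; congr 1; simp [mul_comm, mul_left_comm]
  have e4 : η (-(th * (f * s * s)⁻¹)) = η (t * t) - η (s * s) := by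
    rw [sub_eq_add_neg, ← h.sq_inv, ← h.sq_mul]; congr 1; rw [hth]
    simp only [neg_mul, neg_neg, mul_inv]
    apply Additive.ofMul.injective
    simp only [ofMul_mul, ofMul_inv]
    abel
  have e5 : η (f * s * s * th⁻¹ * th⁻¹) = η (s * s) - η (th * th) + η f := by
    rw [sub_eq_add_neg, ← h.sq_inv, ← h.sq_mul_sq, ← h.sq_mul]; congr 1
    simp only [mul_comm, mul_left_comm, mul_assoc]
  have e6 := h.add_neg f
  rw [e1, e2, e3, e4, e5, h.map_one] at rel
  linear_combination (norm := module) -e6 - rel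

/-- For `f = 5` and `th = 3` in the units modulo a power of two, the hypothesis `rel` is the
relation obtained by expanding `x(2) y(2)` along `2 = 1 + 1 = 3 + (-1)`; the unit `7` is written
`-r²`. -/
lemma two_nsmul_two_nsmul_of_relation (hth : th = -(f * t * t))
    (hf : η (-f) = η (-1) + η f)
    (rel : η (-1) - η (-th⁻¹) + (η (-1) - η (-(th * f⁻¹))) =
      η (-th) - η (-(th * (-(r * r))⁻¹)) + (η 1 - η (-(r * r) * f⁻¹))) :
    η (-1) + η (-1) + (η (-1) + η (-1)) = 0 := by
  have e0 : η (th * th) = η (f * f) + (η (t * t) + η (t * t)) := by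
    rw [hth, neg_mul_neg, ← h.sq_mul_sq, ← h.sq_mul_sq]; congr 1
    simp only [mul_comm, mul_left_comm]
  have e1 : η (-th⁻¹) = -η (th * th) + (η (t * t) + η f) := by
    rw [← h.sq_inv, ← h.sq_mul, ← h.sq_mul]; congr 1
    have : t * t * f = -th := by rw [hth]; simp [mul_comm, mul_left_comm]
    rw [this]; simp
  have e2 : η (-(th * f⁻¹)) = η (t * t) := by
    rw [hth]; congr 1
    rw [neg_mul, neg_neg, mul_comm, ← mul_assoc, ← mul_assoc]; simp
  have e3 : η (-th) = η (t * t) + η f := by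
    rw [hth, ← h.sq_mul]; congr 1; simp [mul_comm, mul_left_comm]
  have e4 : η (-(th * (-(r * r))⁻¹)) = η (t * t) - η (r * r) + η (-f) := by
    rw [sub_eq_add_neg, ← h.sq_inv, ← h.sq_mul_sq, ← h.sq_mul]; congr 1; rw [hth]
    simp [mul_comm, mul_left_comm, mul_assoc]
  have e5 : η (-(r * r) * f⁻¹) = η (r * r) - η (f * f) + η (-f) := by
    rw [sub_eq_add_neg, ← h.sq_inv, ← h.sq_mul_sq, ← h.sq_mul]; congr 1
    rw [neg_mul, mul_neg, neg_inj]
    apply Additive.ofMul.injective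
    simp only [ofMul_mul, ofMul_inv]
    abel
  have e6 := h.add_neg f
  rw [e1, e2, e3, e4, e5, e0, h.map_one, hf] at rel
  rw [hf] at e6
  linear_combination (norm := module) rel

/-- Multiplicativity when the units are generated by `-1` and `f`. -/
lemma map_mul_of_closure (hf : η (-f) = η (-1) + η f) (h1 : η (-1) + η (-1) = 0)
    (hgen : Subgroup.closure {-1, f} = ⊤) (u v : Rˣ) : η (u * v) = η u + η v := by
  have hff : η (f * f) = η f + η f := by
    have := h.add_neg f
    rw [hf] at this
    linear_combination (norm := module) -this
  have hneg : ∀ u, η (-u) = η (-1) + η u := by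
    intro u
    obtain ⟨s, rfl | rfl | rfl | rfl⟩ := Units.exists_sq_mul_of_closure hgen u
    all_goals rw [← mul_neg, h.sq_mul, h.sq_mul]
    · rw [h.map_one]; abel
    · rw [neg_neg, h.map_one]; linear_combination (norm := module) -h1
    · rw [hf]; abel
    · rw [neg_neg, hf]; linear_combination (norm := module) -h1
  have hmul : ∀ u, η (f * u) = η f + η u := by
    intro u
    obtain ⟨s, rfl | rfl | rfl | rfl⟩ := Units.exists_sq_mul_of_closure hgen u
    all_goals rw [mul_left_comm, h.sq_mul, h.sq_mul]
    · rw [h.map_one, mul_one]; abel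
    · rw [mul_neg_one, hneg]; abel
    · rw [hff]; abel
    · rw [mul_neg, hneg, hneg f, hff]; abel
  obtain ⟨s, rfl | rfl | rfl | rfl⟩ := Units.exists_sq_mul_of_closure hgen u
  all_goals rw [mul_assoc, h.sq_mul, h.sq_mul]
  · rw [h.map_one, one_mul]; abel
  · rw [neg_one_mul, hneg]; abel
  · rw [hmul]; abel
  · rw [neg_mul, hneg, hneg f, hmul]; abel

end IsTorusFunction

/-! ### Unit groups modulo prime powers and multiplicativity of the torus elements -/

/-- In a cyclic group the nonsquares form a single class modulo squares. -/
lemma IsCyclic.isSquare_mul_inv {V : Type*} [CommGroup V] [IsCyclic V] {u v : V}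
    (hu : ¬ IsSquare u) (hv : ¬ IsSquare v) : IsSquare (u * v⁻¹) := by
  obtain ⟨g, hg⟩ := IsCyclic.exists_generator (α := V)
  obtain ⟨i, rfl⟩ := hg u
  obtain ⟨j, rfl⟩ := hg v
  have key : ∀ i : ℤ, ¬ IsSquare (g ^ i) → Odd i := by
    intro i hi
    by_contra h
    rw [Int.not_odd_iff_even] at h
    obtain ⟨k, rfl⟩ := h
    exact hi ⟨g ^ k, zpow_add g k k⟩
  obtain ⟨k, hk⟩ := (key i hu).sub_odd (key j hv)
  refine ⟨g ^ k, ?_⟩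
  simp only [← zpow_neg, ← zpow_add]
  rw [← hk, sub_eq_add_neg]

namespace ZMod

/-- Modulo an odd prime power there are two nonsquare units whose sum is `1`. -/
lemma exists_nonsquare_add_eq_one {p b : ℕ} (hp : p.Prime) (hp2 : p ≠ 2) (hb : b ≠ 0) :
    ∃ u v : (ZMod (p ^ b))ˣ, (u : ZMod (p ^ b)) + v = 1 ∧ ¬ IsSquare u ∧ ¬ IsSquare v := by
  have : Fact p.Prime := ⟨hp⟩
  obtain ⟨g, hg⟩ := FiniteField.exists_nonsquare (F := ZMod p) (by rwa [ringChar_zmod_n])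
  have hg0 : g ≠ 0 := by rintro rfl; exact hg (IsSquare.zero)
  -- a nonsquare `g` modulo `p`, whose inverse is a sum of two squares: `1 = g s² + g t²`
  obtain ⟨s, t, hst⟩ := ZMod.sq_add_sq p g⁻¹
  have hginv : ¬ IsSquare g⁻¹ := by rwa [isSquare_inv]
  have hs : s ≠ 0 := by rintro rfl; exact hginv ⟨t, by rw [← hst]; ring⟩
  have ht : t ≠ 0 := by rintro rfl; exact hginv ⟨s, by rw [← hst]; ring⟩
  have hns : ∀ s : ZMod p, s ≠ 0 → ¬ IsSquare (g * s ^ 2) := by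
    rintro s hs ⟨r, hr⟩
    exact hg ⟨r / s, by field_simp; linear_combination hr⟩
  have hsum : g * s ^ 2 + g * t ^ 2 = 1 := by
    rw [← mul_add, hst, mul_inv_cancel₀ hg0]
  obtain ⟨a, ha⟩ := ZMod.intCast_surjective (g * s ^ 2)
  have hdvd : p ∣ p ^ b := dvd_pow_self p hb
  have lift : ∀ a : ℤ, (a : ZMod p) ≠ 0 → ¬ IsSquare (a : ZMod p) →
      ∃ u : (ZMod (p ^ b))ˣ, (u : ZMod (p ^ b)) = a ∧ ¬ IsSquare u := by
    intro a h0 hsq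
    have hu : IsUnit (a : ZMod (p ^ b)) := by
      rw [isUnit_prime_pow_iff hp hb]
      rwa [Ne, ZMod.intCast_zmod_eq_zero_iff_dvd] at h0
    refine ⟨hu.unit, rfl, ?_⟩
    rintro ⟨r, hr⟩
    apply hsq
    have h1 := congrArg (fun z : (ZMod (p ^ b))ˣ => ZMod.castHom hdvd (ZMod p) z) hr
    simp only [IsUnit.unit_spec, Units.val_mul, map_mul, map_intCast] at h1
    exact ⟨_, h1⟩
  obtain ⟨u, hu, hu'⟩ := lift a (by rw [ha]; positivity) (by rw [ha]; exact hns s hs)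
  have hb' : ((1 - a : ℤ) : ZMod p) = g * t ^ 2 := by
    push_cast; rw [ha]; linear_combination -hsum
  obtain ⟨v, hv, hv'⟩ := lift (1 - a) (by rw [hb']; positivity) (by rw [hb']; exact hns t ht)
  exact ⟨u, v, by rw [hu, hv]; push_cast; ring, hu', hv'⟩

/-- The units modulo a power of two are generated by `-1` and `5`. -/
lemma closure_neg_one_five {b : ℕ} (hb : 3 ≤ b) (f : (ZMod (2 ^ b))ˣ)
    (hf : (f : ZMod (2 ^ b)) = 5) : Subgroup.closure {-1, f} = ⊤ := by
  obtain ⟨n, rfl⟩ : ∃ n, b = n + 2 := ⟨b - 2, by omega⟩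
  have h4 : 4 ∣ 2 ^ (n + 2) := ⟨2 ^ n, by ring⟩
  set K := (ZMod.unitsMap h4).ker with hK
  have hord : orderOf f = 2 ^ n := by
    rw [← orderOf_units, hf, orderOf_five]
  have hfK : Subgroup.zpowers f ≤ K := by
    rw [Subgroup.zpowers_le, hK, MonoidHom.mem_ker]
    ext
    rw [ZMod.unitsMap_def]
    simp only [Units.coe_map, MonoidHom.coe_coe, hf, Units.val_one]
    rw [map_ofNat]; rfl
  have hcard : Nat.card K * 2 = 2 ^ n * 2 := by
    have h1 := Subgroup.card_mul_index K
    rw [hK, Subgroup.index_ker, MonoidHom.range_eq_top.2 (ZMod.unitsMap_surjective h4),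
      Subgroup.card_top, Nat.card_eq_fintype_card (α := (ZMod 4)ˣ),
      Nat.card_eq_fintype_card (α := (ZMod (2 ^ (n + 2)))ˣ), ZMod.card_units_eq_totient,
      ZMod.card_units_eq_totient, Nat.totient_prime_pow_succ Nat.prime_two] at h1
    rw [show Nat.totient 4 = 2 by decide] at h1
    rw [hK, h1, pow_succ]; simp
  have hKeq : Subgroup.zpowers f = K := by
    apply Subgroup.eq_of_le_of_card_ge hfK
    rw [Nat.card_zpowers, hord]
    omega
  rw [eq_top_iff]
  intro u _
  have h1 : ZMod.unitsMap h4 u = 1 ∨ ZMod.unitsMap h4 u = -1 := by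
    generalize ZMod.unitsMap h4 u = y
    revert y; decide
  have hsub : K ≤ Subgroup.closure {-1, f} := by
    rw [← hKeq, Subgroup.zpowers_le]
    exact Subgroup.subset_closure (by simp)
  rcases h1 with h1 | h1
  · exact hsub h1
  · have h2 : -1 * u ∈ Subgroup.closure {-1, f} := by
      apply hsub
      rw [hK, MonoidHom.mem_ker, map_mul, h1]
      ext
      rw [ZMod.unitsMap_def]
      simp
    exact (Subgroup.mul_mem_cancel_left _ (Subgroup.subset_closure (by simp))).1 h2

/-- A unit modulo a power of two that is `1` modulo `8` is a square. -/
lemma isSquare_of_castHom_eight {b : ℕ} (hb : 3 ≤ b) (u : (ZMod (2 ^ b))ˣ)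
    (hu : ZMod.castHom (pow_dvd_pow 2 hb) (ZMod (2 ^ 3)) u = 1) : ∃ s, u = s * s := by
  have h5 : IsUnit (5 : ZMod (2 ^ b)) := by
    have := (isUnit_prime_pow_iff Nat.prime_two (b := b) (by omega) 5).2 (by decide)
    exact_mod_cast this
  obtain ⟨f, hf⟩ := h5
  have key : ∀ x y e : (ZMod (2 ^ 3)), y * x = 1 → x * x * e = 1 → e = 1 := by decide
  obtain ⟨s, hs⟩ := Units.exists_sq_mul_of_closure (closure_neg_one_five hb f hf) u
  refine ⟨s, ?_⟩
  have hs1 : ZMod.castHom (pow_dvd_pow 2 hb) (ZMod (2 ^ 3)) (s⁻¹ : (ZMod (2 ^ b))ˣ) *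
      ZMod.castHom (pow_dvd_pow 2 hb) (ZMod (2 ^ 3)) s = 1 := by
    rw [← map_mul, Units.inv_mul, map_one]
  rcases hs with hs | hs | hs | hs
  · simpa using hs
  all_goals
    exfalso
    rw [hs] at hu
    simp only [Units.val_mul, Units.val_neg, Units.val_one, hf, map_mul, map_neg, map_one,
      map_ofNat] at hu
    have := key _ _ _ hs1 hu
    revert this
    decide

end ZMod

namespace RootPair.IsSteinberg

universe u v

variable {R : Type u} {G : Type v} [CommRing R] [Group G] {D : RootPair R G}

open scoped IsMulCommutative in
/-- The torus elements generate an abelian group, in which they form a torus function. -/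
lemma exists_torusFunction (h : D.IsSteinberg) :
    ∃ (A : Type v) (_ : AddCommGroup A) (η : Rˣ → A) (j : Multiplicative A →* G),
      Function.Injective j ∧ (∀ u, j (Multiplicative.ofAdd (η u)) = D.H u) ∧
      IsTorusFunction η := by
  have : IsMulCommutative (Subgroup.closure (Set.range D.H)) :=
    Subgroup.isMulCommutative_closure (by
      rintro _ ⟨u, rfl⟩ _ ⟨v, rfl⟩
      exact h.H_comm u v)
  refine ⟨Additive (Subgroup.closure (Set.range D.H)), inferInstance,
    fun u => Additive.ofMul ⟨D.H u, Subgroup.subset_closure ⟨u, rfl⟩⟩,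
    ⟨⟨fun a => (Additive.toMul a.toAdd : Subgroup.closure (Set.range D.H)).1, rfl⟩,
      fun _ _ => rfl⟩, ?_, fun _ => rfl, ?_, ?_⟩
  · intro a b hab
    exact Subtype.ext hab
  · intro u v
    exact Subtype.ext (h.H_sq_mul u v)
  · intro u
    exact Subtype.ext (h.H_mul_H_neg u)

/-- Over `ℤ/pᵇ` with `p` odd, the torus elements of Steinberg data are multiplicative. -/
theorem H_mul_of_odd {p b : ℕ} (hp : p.Prime) (hp2 : p ≠ 2) (hb : b ≠ 0)
    {D : RootPair (ZMod (p ^ b)) G} (h : D.IsSteinberg) (u v : (ZMod (p ^ b))ˣ) :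
    D.H (u * v) = D.H u * D.H v := by
  obtain ⟨A, _, η, j, hj, hη, hT⟩ := h.exists_torusFunction
  have := ZMod.isCyclic_units_of_prime_pow p hp hp2 b
  obtain ⟨u₀, v₀, h1, hu₀, hv₀⟩ := ZMod.exists_nonsquare_add_eq_one hp hp2 hb
  have rel := h.torus_relation_of_add_eq_one u₀ v₀ h1
  simp only [← hη, ← map_mul, ← ofAdd_add] at rel ⊢
  rw [hT.map_mul_of_nonsquare hu₀ hv₀ (hT.add_of_relation (hj rel))
    (fun u v hu hv => IsCyclic.isSquare_mul_inv hu hv)]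

section Two

variable {b : ℕ} (hb : 3 ≤ b) {D : RootPair (ZMod (2 ^ b)) G} (h : D.IsSteinberg)
include hb h

/-- Over `ℤ/2ᵇ` with `b ≥ 3`, Steinberg data satisfy `H(-1)⁴ = 1`, and the only obstruction to the
multiplicativity of the torus elements is `H(-1)²`. -/
lemma H_neg_one_relations : D.H (-1) * D.H (-1) * (D.H (-1) * D.H (-1)) = 1 ∧
    (D.H (-1) * D.H (-1) = 1 → ∀ u v, D.H (u * v) = D.H u * D.H v) := by
  obtain ⟨A, _, η, j, hj, hη, hT⟩ := h.exists_torusFunction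
  have unit : ∀ c : ℤ, ¬ (2 : ℤ) ∣ c → ∃ u : (ZMod (2 ^ b))ˣ, (u : ZMod (2 ^ b)) = c := by
    intro c hc
    exact (ZMod.isUnit_prime_pow_iff Nat.prime_two (by omega) c).2 hc
  obtain ⟨f, hf⟩ := unit 5 (by decide)
  obtain ⟨th, hth⟩ := unit 3 (by decide)
  obtain ⟨tw, htw⟩ := unit 13 (by decide)
  obtain ⟨sv, hsv⟩ := unit 7 (by decide)
  push_cast at hf hth htw hsv
  set π := ZMod.castHom (pow_dvd_pow 2 hb) (ZMod (2 ^ 3)) with hπ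
  have key : ∀ x : (ZMod (2 ^ 3)), x * 5 = 1 → x = 5 := by decide
  have hfinv : π (f⁻¹ : (ZMod (2 ^ b))ˣ) = 5 := by
    apply key
    have : ((f⁻¹ : (ZMod (2 ^ b))ˣ) : ZMod (2 ^ b)) * 5 = 1 := by rw [← hf]; simp
    have := congrArg π this
    simpa only [map_mul, map_ofNat, map_one] using this
  have sq : ∀ u : (ZMod (2 ^ b))ˣ, π u = 1 → ∃ s, u = s * s :=
    ZMod.isSquare_of_castHom_eight hb
  -- `-3 / 5`, `13 / 5` and `-7` are squares, being `1` modulo `8`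
  obtain ⟨t, ht⟩ := sq (-(th * f⁻¹)) (by
    simp only [Units.val_neg, Units.val_mul, map_neg, map_mul, hfinv, hth, map_ofNat]; decide)
  obtain ⟨s, hs⟩ := sq (tw * f⁻¹) (by
    simp only [Units.val_mul, map_mul, hfinv, htw, map_ofNat]; decide)
  obtain ⟨r, hr⟩ := sq (-sv) (by
    simp only [Units.val_neg, map_neg, hsv, map_ofNat]; decide)
  have eth : th = -(f * t * t) := by rw [mul_assoc, ← ht]; simp
  have etw : tw = f * s * s := by rw [mul_assoc, ← hs]; simp
  have esv : sv = -(r * r) := by rw [← hr]; simp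
  -- `2 = 1 + 1 = 3 + (-1)` with `a = 4`: `1 + 4 = 5`, `1 + 4 · 2 = 9`, `1 + 4 · 3 = 13`
  have rel1 := h.torus_relation_of_add_eq_add 4 1 1 th (-1) f (th * th * f⁻¹) tw
    (th * th * tw⁻¹) (by rw [hth]; push_cast; norm_num) (by rw [hf]; push_cast; norm_num)
    (by push_cast; rw [hth, mul_comm, mul_assoc, Units.inv_mul, mul_one]; norm_num)
    (by rw [htw, hth]; norm_num) (by simp)
  -- the same decompositions with `a = 2`: `1 + 2 = 3`, `1 + 2 · 2 = 5`, `1 + 2 · 3 = 7`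
  have rel2 := h.torus_relation_of_add_eq_add 2 1 1 th (-1) th (f * th⁻¹) sv
    (f * sv⁻¹) (by rw [hth]; push_cast; norm_num) (by rw [hth]; push_cast; norm_num)
    (by push_cast; rw [hf, mul_comm, mul_assoc, Units.inv_mul, mul_one]; norm_num)
    (by rw [hsv, hth]; norm_num) (by simp)
  simp only [← hη, ← map_mul, ← map_inv, ← ofAdd_add, ← ofAdd_neg, ← sub_eq_add_neg] at rel1 rel2
  have rel1 := Multiplicative.ofAdd.injective (hj rel1)
  have rel2 := Multiplicative.ofAdd.injective (hj rel2)
  have hneg : η (-f) = η (-1) + η f := by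
    refine hT.map_neg_of_relation eth (s := s) ?_
    rw [← etw]
    convert rel1 using 5
    all_goals simp [mul_assoc, mul_comm]
  have h4 : η (-1) + η (-1) + (η (-1) + η (-1)) = 0 := by
    refine hT.two_nsmul_two_nsmul_of_relation eth hneg (r := r) ?_
    rw [← esv]
    convert rel2 using 5
    all_goals simp [mul_comm]
  refine ⟨?_, fun h1 u v => ?_⟩
  · simp only [← hη, ← map_mul, ← ofAdd_add, h4]; simp
  · have h2 : η (-1) + η (-1) = 0 := by
      simp only [← hη, ← map_mul, ← ofAdd_add] at h1
      exact Multiplicative.ofAdd.injective (hj (h1.trans (map_one j).symm))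
    simp only [← hη, ← map_mul, ← ofAdd_add]
    rw [hT.map_mul_of_closure hneg h2 (ZMod.closure_neg_one_five hb f hf)]

end Two

end RootPair.IsSteinberg

/-! ### Central extensions by scalars -/

/-- A central extension `kˣ → G → Q`; the model is `kˣ → GL_r(k) → PGL_r(k)`. -/
structure IsScalarExtension {k G Q : Type*} [Field k] [Group G] [Group Q] (ι : kˣ →* G)
    (π : G →* Q) : Prop where
  injective : Function.Injective ι
  central : ∀ z g, ι z * g = g * ι z
  surjective : Function.Surjective π
  ker_eq : π.ker = ι.range

namespace IsScalarExtension

open SLTwo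

variable {k G Q : Type*} [Field k] [Group G] [Group Q] {ι : kˣ →* G} {π : G →* Q}
  (h : IsScalarExtension ι π)
include h

lemma map_scalar (z : kˣ) : π (ι z) = 1 := by
  rw [← MonoidHom.mem_ker, h.ker_eq]; exact ⟨z, rfl⟩

lemma exists_scalar {g : G} (hg : π g = 1) : ∃ z, g = ι z := by
  rw [← MonoidHom.mem_ker, h.ker_eq] at hg
  obtain ⟨z, hz⟩ := hg
  exact ⟨z, hz.symm⟩

lemma exists_eq_mul {g g' : G} (hg : π g = π g') : ∃ z, g = g' * ι z := by
  obtain ⟨z, hz⟩ := h.exists_scalar (g := g'⁻¹ * g) (by simp [hg])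
  exact ⟨z, by rw [← hz]; group⟩

/-- The action of `Q` on `G` by conjugation with lifts, which does not depend on the lifts because
the kernel of `π` is central. -/
noncomputable def conjHom : Q →* MulAut G :=
  π.liftOfSurjective h.surjective ⟨MulAut.conj, by
    intro g hg
    obtain ⟨z, rfl⟩ := h.exists_scalar (MonoidHom.mem_ker.1 hg)
    rw [MonoidHom.mem_ker]
    ext y
    simp [h.central z y]⟩

lemma conjHom_apply (g y : G) : h.conjHom (π g) y = g * y * g⁻¹ := by
  have : h.conjHom (π g) = MulAut.conj g :=
    MonoidHom.liftOfRightInverse_comp_apply _ _ _ _ _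
  rw [this]; simp

lemma map_conjHom (q : Q) (y : G) : π (h.conjHom q y) = q * π y * q⁻¹ := by
  obtain ⟨g, rfl⟩ := h.surjective q
  rw [conjHom_apply]; simp

lemma conjHom_scalar (q : Q) (z : kˣ) : h.conjHom q (ι z) = ι z := by
  obtain ⟨g, rfl⟩ := h.surjective q
  rw [conjHom_apply, ← h.central]; simp

lemma scalar_mul_pow (g : G) (z : kˣ) (n : ℕ) : (g * ι z) ^ n = g ^ n * ι (z ^ n) := by
  rw [map_pow]
  exact Commute.mul_pow (h.central z g).symm n

/-- The elements of `Q` whose lifts commute with the lifts of `q`. This subgroup of the centralizer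
of `q` is in general smaller than the centralizer. -/
def liftCentralizer (q : Q) : Subgroup Q where
  carrier := {q' | ∀ g, π g = q → h.conjHom q' g = g}
  one_mem' := by intro g _; simp
  mul_mem' := by
    intro a b ha hb g hg
    rw [map_mul, MulAut.mul_apply, hb g hg, ha g hg]
  inv_mem' := by
    intro a ha g hg
    rw [map_inv, MulAut.inv_apply, MulEquiv.symm_apply_eq, ha g hg]

lemma mem_liftCentralizer_iff {q q' : Q} {g g' : G} (hg : π g = q) (hg' : π g' = q') :
    q' ∈ h.liftCentralizer q ↔ g' * g = g * g' := by
  constructor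
  · intro hq
    have := hq g hg
    rw [← hg', conjHom_apply, mul_inv_eq_iff_eq_mul] at this
    exact this
  · intro hgg y hy
    obtain ⟨z, rfl⟩ := h.exists_eq_mul (hy.trans hg.symm)
    rw [map_mul, conjHom_scalar, ← hg', conjHom_apply, hgg]
    group

lemma mem_liftCentralizer_comm {q q' : Q} :
    q' ∈ h.liftCentralizer q ↔ q ∈ h.liftCentralizer q' := by
  obtain ⟨g, hg⟩ := h.surjective q
  obtain ⟨g', hg'⟩ := h.surjective q'
  rw [h.mem_liftCentralizer_iff hg hg', h.mem_liftCentralizer_iff hg' hg, eq_comm]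

lemma mem_liftCentralizer_self (q : Q) : q ∈ h.liftCentralizer q := by
  obtain ⟨g, hg⟩ := h.surjective q
  rw [h.mem_liftCentralizer_iff hg hg]

lemma conj_mem_liftCentralizer {q q' : Q} (hq : q' ∈ h.liftCentralizer q) (r : Q) :
    r * q' * r⁻¹ ∈ h.liftCentralizer (r * q * r⁻¹) := by
  obtain ⟨g, rfl⟩ := h.surjective q
  obtain ⟨g', rfl⟩ := h.surjective q'
  obtain ⟨y, rfl⟩ := h.surjective r
  rw [h.mem_liftCentralizer_iff rfl rfl] at hq
  rw [← map_inv, ← map_mul, ← map_mul, ← map_mul, ← map_mul, h.mem_liftCentralizer_iff rfl rfl]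
  calc _ = y * (g' * g) * y⁻¹ := by group
    _ = _ := by rw [hq]; group

/-- The root pair attached to a lift `X` of the upper unipotent group under `φ : SL₂(R) → Q`. Its
Weyl element is the product `x(1) y(-1) x(1)`, in which `y(-1)` is the conjugate of `x(1)` by any
lift of `φ wt`. -/
noncomputable def rootPair {R : Type*} [CommRing R] (φ : SL(2, R) →* Q) (X : R → G)
    (X_add : ∀ a b, X (a + b) = X a * X b) : RootPair R G :=
  ⟨X, X 1 * h.conjHom (φ wt) (X 1) * X 1, X_add⟩

variable
  {R : Type*} [CommRing R] {φ : SL(2, R) →* Q} {X : R → G}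
  {X_add : ∀ a b, X (a + b) = X a * X b} (hX : ∀ b, π (X b) = φ (x b))
include h hX

lemma map_rootPair_w : π (h.rootPair φ X X_add).w = φ wt := by
  have e : wt * x 1 * wt⁻¹ = (yl (-1) : SL(2, R)) := by rw [wt_x]; group
  have := x_yl_x (1 : Rˣ)
  simp only [Units.val_one, inv_one, dg_one, one_mul] at this
  rw [← this, ← e]
  simp only [rootPair, map_mul, h.map_conjHom, hX, map_inv]

lemma rootPair_Y (b : R) : (h.rootPair φ X X_add).Y b = h.conjHom (φ wt) (X (-b)) := by
  rw [← h.map_rootPair_w hX (X_add := X_add), conjHom_apply]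
  rfl

lemma map_rootPair_W (u : Rˣ) : π ((h.rootPair φ X X_add).W u) = φ (dg u) * φ wt := by
  have e : wt * x ((u⁻¹ : Rˣ) : R) * wt⁻¹ = (yl (-((u⁻¹ : Rˣ) : R)) : SL(2, R)) := by
    rw [wt_x]; group
  rw [← map_mul, ← x_yl_x, ← e, RootPair.W, h.rootPair_Y hX]
  simp only [rootPair, map_mul, h.map_conjHom, hX, map_inv, neg_neg]

lemma map_rootPair_H (u : Rˣ) : π ((h.rootPair φ X X_add).H u) = φ (dg u) := by
  rw [RootPair.H, map_mul, map_inv, h.map_rootPair_W hX, h.map_rootPair_w hX]; group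

/-- A lift of the unipotent group on which the torus acts as in `SL₂(R)` gives Steinberg data,
provided that the lifts of the torus commute with each other. -/
lemma isSteinberg_rootPair (hdg : ∀ (u : Rˣ) b, h.conjHom (φ (dg u)) (X b) = X (u * u * b))
    (hcomm : ∀ u v : Rˣ, φ (dg u) ∈ h.liftCentralizer (φ (dg v))) :
    (h.rootPair φ X X_add).IsSteinberg where
  W_one := by
    rw [RootPair.W, h.rootPair_Y hX]
    simp [rootPair]
  w_sq_X b := by
    have h1 := hdg (-1) b
    have h2 : π ((h.rootPair φ X X_add).w * (h.rootPair φ X X_add).w) = φ (dg (-1)) := by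
      rw [map_mul, h.map_rootPair_w hX, ← map_mul, wt_wt]
    rw [← h2, conjHom_apply, mul_inv_eq_iff_eq_mul] at h1
    change _ * X b = X b * _
    simpa using h1
  H_X u b := by
    have h1 := hdg u b
    rwa [← h.map_rootPair_H hX (X_add := X_add), conjHom_apply, mul_inv_eq_iff_eq_mul] at h1
  H_Y u b := by
    have h1 : h.conjHom (φ (dg u)) (h.conjHom (φ wt) (X (-b))) =
        h.conjHom (φ wt) (X (-((u⁻¹ : Rˣ) * (u⁻¹ : Rˣ) * b))) := by
      rw [← MulAut.mul_apply, ← map_mul, ← map_mul, dg_wt, map_mul, map_mul, MulAut.mul_apply,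
        hdg, mul_neg]
    rw [← h.map_rootPair_H hX (X_add := X_add), conjHom_apply, mul_inv_eq_iff_eq_mul] at h1
    rw [h.rootPair_Y hX, h.rootPair_Y hX, h1]
  H_comm u v := (h.mem_liftCentralizer_iff (h.map_rootPair_H hX v) (h.map_rootPair_H hX u)).1
    (hcomm u v)

end IsScalarExtension

/-! ### Lifting the unipotent group, and odd prime powers -/

lemma IsAlgClosed.exists_units_pow_eq {k : Type*} [Field k] [IsAlgClosed k] (z : kˣ) {d : ℕ}
    (hd : 0 < d) : ∃ y : kˣ, y ^ d = z := by
  obtain ⟨y, hy⟩ := IsAlgClosed.exists_pow_nat_eq (z : k) hd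
  have hy0 : y ≠ 0 := by
    rintro rfl
    rw [zero_pow hd.ne'] at hy
    exact z.ne_zero hy.symm
  exact ⟨Units.mk0 y hy0, by ext; simpa using hy⟩

/-- If `z` is a `q`-th root of unity and `e` is prime to `q`, then `z` has a `d e`-th root which
is a `d q`-th root of unity. -/
lemma IsAlgClosed.exists_units_pow_eq_of_coprime {k : Type*} [Field k] [IsAlgClosed k] (z : kˣ)
    {d e q : ℕ} (hd : 0 < d) (he : Nat.Coprime e q) (hz : z ^ q = 1) :
    ∃ y : kˣ, y ^ (d * e) = z ∧ y ^ (d * q) = 1 := by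
  obtain ⟨y, hy⟩ := IsAlgClosed.exists_units_pow_eq z hd
  have hz' : orderOf z ∣ q := orderOf_dvd_of_pow_eq_one hz
  have hcop : (orderOf z).Coprime e := (he.coprime_dvd_right hz').symm
  obtain ⟨j, hj⟩ := exists_pow_eq_self_of_coprime hcop.symm
  refine ⟨y ^ j, ?_, ?_⟩
  · rw [← pow_mul, mul_comm j, mul_assoc, pow_mul, hy, pow_mul, hj]
  · rw [← pow_mul, mul_comm j, mul_assoc, pow_mul, hy, pow_mul, hz, one_pow]

/-- The one-parameter family of powers of an element with `t ^ m = 1`. -/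
lemma ZMod.exists_powers {G : Type*} [Group G] {m : ℕ} (t : G) (ht : t ^ m = 1) :
    ∃ X : ZMod m → G, (∀ a b, X (a + b) = X a * X b) ∧ ∀ n : ℕ, X n = t ^ n := by
  let f : ℤ →+ Additive G := zmultiplesHom (Additive G) (Additive.ofMul t)
  have hf : f m = 0 := by
    simp only [f, zmultiplesHom_apply, natCast_zsmul, ← ofMul_pow, ht, ofMul_one]
  refine ⟨fun a => (ZMod.lift m ⟨f, hf⟩ a).toMul, fun a b => by simp, fun n => ?_⟩
  have := ZMod.lift_coe m ⟨f, hf⟩ (n : ℤ)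
  rw [Int.cast_natCast] at this
  simp only [this, f, zmultiplesHom_apply, natCast_zsmul, ← ofMul_pow, toMul_ofMul]

namespace SLTwo

lemma x_natCast {R : Type*} [CommRing R] (n : ℕ) : x (n : R) = x 1 ^ n := by
  induction n with
  | zero => simp [x_zero]
  | succ n ih => rw [Nat.cast_succ, x_add, ih, pow_succ]

lemma dg_mul_x_mul_inv {R : Type*} [CommRing R] (u : Rˣ) (b : R) :
    dg u * x b * (dg u)⁻¹ = x (u * u * b) := by
  rw [dg_x, mul_inv_cancel_right]

lemma yl_add {R : Type*} [CommRing R] (a b : R) : yl (a + b) = yl a * yl b := by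
  simp [ext_iff', mul_apply]

lemma yl_natCast_mul {R : Type*} [CommRing R] (n : ℕ) (b : R) : yl (n * b) = yl b ^ n := by
  induction n with
  | zero => simp [ext_iff']
  | succ n ih => rw [Nat.cast_succ, add_mul, one_mul, yl_add, ih, pow_succ]

end SLTwo

namespace IsScalarExtension

open SLTwo

variable {k G Q : Type*} [Field k] [Group G] [Group Q] {ι : kˣ →* G} {π : G →* Q}
  (h : IsScalarExtension ι π) {m : ℕ} {φ : SL(2, ZMod m) →* Q}
include h

/-- A lift of the standard unipotent element, normalised to have order dividing `m`. -/
lemma exists_lift_pow_eq_one [IsAlgClosed k] (hm : 0 < m) (φ : SL(2, ZMod m) →* Q) :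
    ∃ t : G, π t = φ (x 1) ∧ t ^ m = 1 := by
  obtain ⟨t₀, ht₀⟩ := h.surjective (φ (x 1))
  obtain ⟨a, ha⟩ := h.exists_scalar (g := t₀ ^ m) (by
    rw [map_pow, ht₀, ← map_pow, ← x_natCast, ZMod.natCast_self, x_zero, map_one])
  obtain ⟨y, hy⟩ := IsAlgClosed.exists_units_pow_eq a⁻¹ hm
  refine ⟨t₀ * ι y, by rw [map_mul, h.map_scalar, mul_one, ht₀], ?_⟩
  rw [h.scalar_mul_pow, ha, hy, ← map_mul, mul_inv_cancel, map_one]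

/-- The lift of the unipotent element can be adjusted so that conjugation by the lift of one
given torus element acts on it as in `SL₂`. The factor `y` has to satisfy `y ^ (N - 1) = z`, where
`N` represents `u²`, and `y ^ m = 1`. -/
lemma exists_equivariant_lift [IsAlgClosed k] (hm : 0 < m) {t : G} (ht : π t = φ (x 1))
    (htm : t ^ m = 1) (u : (ZMod m)ˣ) (N d e q : ℕ) (hN : (N : ZMod m) = u * u)
    (hNd : N = d * e + 1) (hd : 0 < d) (hm' : d * q = m) (he : Nat.Coprime e q) (z : kˣ)
    (hz : h.conjHom (φ (dg u)) t = t ^ N * ι z) (hzq : z ^ q = 1) :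
    ∃ X : ZMod m → G, (∀ a b, X (a + b) = X a * X b) ∧ (∀ b, π (X b) = φ (x b)) ∧
      ∀ b, h.conjHom (φ (dg u)) (X b) = X (u * u * b) := by
  have : NeZero m := ⟨hm.ne'⟩
  obtain ⟨y, hy, hy'⟩ := IsAlgClosed.exists_units_pow_eq_of_coprime z hd he hzq
  obtain ⟨X, X_add, hX⟩ := ZMod.exists_powers (m := m) (t * ι y) (by
    rw [h.scalar_mul_pow, htm, ← hm', hy']; simp)
  refine ⟨X, X_add, fun b => ?_, fun b => ?_⟩
  · rw [← ZMod.natCast_zmod_val b, hX, x_natCast, map_pow, map_pow, map_mul, h.map_scalar, ht,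
      mul_one]
  · have h1 : h.conjHom (φ (dg u)) (t * ι y) = (t * ι y) ^ N := by
      rw [map_mul, hz, h.conjHom_scalar, h.scalar_mul_pow, hNd, pow_succ y, hy, map_mul,
        mul_assoc]
    rw [← ZMod.natCast_zmod_val b, ← hN, ← Nat.cast_mul, hX, hX, map_pow, h1, pow_mul]

/-- Equivariance under the torus holds as soon as it holds for generators. -/
lemma equivariant_of_closure {R : Type*} [CommRing R] {φ : SL(2, R) →* Q} {X : R → G}
    {s : Set Rˣ} (hs : Subgroup.closure s = ⊤)
    (hX : ∀ u ∈ s, ∀ b, h.conjHom (φ (dg u)) (X b) = X (u * u * b)) (u : Rˣ) (b : R) :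
    h.conjHom (φ (dg u)) (X b) = X (u * u * b) := by
  have hu : u ∈ Subgroup.closure s := by rw [hs]; trivial
  induction hu using Subgroup.closure_induction generalizing b with
  | mem u hu => exact hX u hu b
  | one => simp [dg_one]
  | mul u v _ _ hu hv =>
    rw [dg_mul, map_mul, map_mul, MulAut.mul_apply, hv, hu]
    congr 1; push_cast; ring
  | inv u _ hu =>
    have h1 : φ (dg u⁻¹) = (φ (dg u))⁻¹ := by
      rw [← map_inv, eq_comm]; congr 1
      rw [inv_eq_iff_mul_eq_one, ← dg_mul]; simp [dg_one]
    rw [h1, map_inv, MulAut.inv_apply, MulEquiv.symm_apply_eq, hu]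
    congr 1
    have : (u : R) * (u⁻¹ : Rˣ) = 1 := by simp
    linear_combination (-(1 + (u : R) * (u⁻¹ : Rˣ)) * b) * this

/-- The lifts of the torus commute as soon as those of generators do. -/
lemma torus_commute_of_closure {R : Type*} [CommRing R] {φ : SL(2, R) →* Q}
    {s : Set Rˣ} (hs : Subgroup.closure s = ⊤)
    (hcomm : ∀ u ∈ s, ∀ v ∈ s, φ (dg u) ∈ h.liftCentralizer (φ (dg v))) (u v : Rˣ) :
    φ (dg u) ∈ h.liftCentralizer (φ (dg v)) := by
  let dgHom : Rˣ →* SL(2, R) := ⟨⟨dg, dg_one⟩, dg_mul⟩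
  have key : ∀ v, (∀ u ∈ s, φ (dg u) ∈ h.liftCentralizer (φ (dg v))) →
      ∀ u, φ (dg u) ∈ h.liftCentralizer (φ (dg v)) := by
    intro v hv u
    have : (⊤ : Subgroup Rˣ) ≤ (h.liftCentralizer (φ (dg v))).comap (φ.comp dgHom) := by
      rw [← hs, Subgroup.closure_le]
      exact hv
    exact this (Subgroup.mem_top u)
  refine key v (fun u hu => ?_) u
  rw [h.mem_liftCentralizer_comm]
  exact key u (fun v hv => hcomm v hv u hu) v

/-- Steinberg data with multiplicative torus elements yield a linear lift. -/
lemma exists_hom_of_rootPair (hm : 0 < m) [IsLocalRing (ZMod m)] {X : ZMod m → G}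
    {X_add : ∀ a b, X (a + b) = X a * X b} (hX : ∀ b, π (X b) = φ (x b))
    (hS : (h.rootPair φ X X_add).IsSteinberg)
    (hmul : ∀ u v, (h.rootPair φ X X_add).H (u * v) =
      (h.rootPair φ X X_add).H u * (h.rootPair φ X X_add).H v) :
    ∃ Φ : SL(2, ZMod m) →* G, ∀ M, π (Φ M) = φ M := by
  obtain ⟨Φ, h1, h2⟩ := hS.exists_hom hmul (closure_x_wt m hm)
  refine ⟨Φ, fun M => ?_⟩
  have : π.comp Φ = φ := by
    apply MonoidHom.eq_of_eqOn_dense (closure_x_wt m hm)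
    rintro g (rfl | rfl)
    · rw [MonoidHom.comp_apply, h1]; exact hX 1
    · rw [MonoidHom.comp_apply, h2]; exact h.map_rootPair_w hX
  rw [← this]; rfl

/-- Conjugation by a lift of a torus element multiplies the normalised unipotent element by a
scalar, up to the expected power. -/
lemma exists_conj_eq {t : G} (ht : π t = φ (x 1)) (u : (ZMod m)ˣ) (N : ℕ)
    (hN : (N : ZMod m) = u * u) : ∃ z, h.conjHom (φ (dg u)) t = t ^ N * ι z := by
  apply h.exists_eq_mul
  rw [h.map_conjHom, map_pow, ht, ← map_inv, ← map_mul, ← map_mul, dg_mul_x_mul_inv, mul_one,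
    ← hN, x_natCast, map_pow]

/-- For odd `p`, a homomorphism `φ` from `SL₂(ℤ/pᶜ⁺ᵃ)` to `Q` that sends `x(pᵃ)` to `1` lifts to
`G`, where `c = 0` if `p ≥ 5` and `c = 1` if `p = 3`. The exponent `c` is that of `p` in `u² - 1`
for a primitive root `u`. -/
theorem exists_hom_of_odd [IsAlgClosed k] {p a c : ℕ} (hp : p.Prime) (hp2 : p ≠ 2) (ha : a ≠ 0)
    (hc : c = 0 ∧ 5 ≤ p ∨ c = 1 ∧ p = 3) (φ : SL(2, ZMod (p ^ (c + a))) →* Q)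
    (hφ : φ (x ((p ^ a : ℕ) : ZMod (p ^ (c + a)))) = 1) :
    ∃ Φ : SL(2, ZMod (p ^ (c + a))) →* G, ∀ M, π (Φ M) = φ M := by
  have hm : 0 < p ^ (c + a) := pow_pos hp.pos _
  have hlt : 1 < p ^ (c + a) := Nat.one_lt_pow (by omega) hp.one_lt
  have : NeZero (p ^ (c + a)) := ⟨hm.ne'⟩
  have := ZMod.isLocalRing_prime_pow hp (b := c + a) (by omega)
  have := ZMod.isCyclic_units_of_prime_pow p hp hp2 (c + a)
  obtain ⟨u, hu⟩ := IsCyclic.exists_generator (α := (ZMod (p ^ (c + a)))ˣ)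
  have hgen : Subgroup.closure {u} = ⊤ := by
    rw [← Subgroup.zpowers_eq_closure, eq_top_iff]; exact fun v _ => hu v
  obtain ⟨t, ht, htm⟩ := h.exists_lift_pow_eq_one hm φ
  set N := ((u : ZMod (p ^ (c + a))) * u).val with hNdef
  have hN : (N : ZMod (p ^ (c + a))) = u * u := by rw [hNdef, ZMod.natCast_zmod_val]
  have hN0 : 1 ≤ N := by
    rw [Nat.one_le_iff_ne_zero]
    intro h0
    rw [h0, Nat.cast_zero, eq_comm, ← Units.val_mul] at hN
    exact (u * u).ne_zero hN
  obtain ⟨z, hz⟩ := h.exists_conj_eq ht u N hN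
  -- the square of a unit is `1` modulo `p ^ c`
  obtain ⟨e, he⟩ : p ^ c ∣ N - 1 := by
    rcases hc with ⟨rfl, -⟩ | ⟨rfl, rfl⟩
    · simp
    · have hdvd : 3 ^ 1 ∣ 3 ^ (1 + a) := pow_dvd_pow 3 (by omega)
      have key : ∀ y : (ZMod (3 ^ 1))ˣ, (y : ZMod (3 ^ 1)) * (y : ZMod (3 ^ 1)) = 1 := by decide
      have h1 := key (ZMod.unitsMap hdvd u)
      have h2 := congrArg (ZMod.castHom hdvd (ZMod (3 ^ 1))) hN
      rw [map_mul, map_natCast] at h2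
      rw [← (ZMod.natCast_eq_zero_iff (N - 1) (3 ^ 1)), Nat.cast_sub hN0, h2, Nat.cast_one,
        sub_eq_zero]
      exact h1
  have heN : N = p ^ c * e + 1 := by omega
  -- a generator does not square to `1` modulo `p ^ (c + 1)`, because `2 ^ 2` is not `1`
  have hpe : ¬ p ∣ e := by
    intro hdiv
    have hdvd : p ^ (c + 1) ∣ p ^ (c + a) := pow_dvd_pow p (by omega)
    have h1 : ZMod.unitsMap hdvd u * ZMod.unitsMap hdvd u = 1 := by
      have h2 := congrArg (ZMod.castHom hdvd (ZMod (p ^ (c + 1)))) hN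
      have h3 : ((N : ℕ) : ZMod (p ^ (c + 1))) = 1 := by
        obtain ⟨e', rfl⟩ := hdiv
        rw [heN, ← mul_assoc, ← pow_succ]
        push_cast
        rw [← Nat.cast_pow, ZMod.natCast_self]; simp
      rw [map_natCast, h3, map_mul] at h2
      ext
      exact h2.symm
    have h2u : IsUnit ((2 : ℤ) : ZMod (p ^ (c + a))) := by
      rw [ZMod.isUnit_prime_pow_iff hp (by omega)]
      intro h2
      exact hp2 ((Nat.prime_dvd_prime_iff_eq hp Nat.prime_two).1 (by exact_mod_cast h2))
    obtain ⟨i, hi⟩ := hu h2u.unit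
    have h4 : ZMod.unitsMap hdvd h2u.unit * ZMod.unitsMap hdvd h2u.unit = 1 := by
      have hi' : u ^ i = h2u.unit := hi
      rw [← hi', map_zpow, ← mul_zpow, h1, one_zpow]
    have h5 : ((4 : ℕ) : ZMod (p ^ (c + 1))) = (1 : ℕ) := by
      have := congrArg Units.val h4
      rw [ZMod.unitsMap_def] at this
      simp only [Units.val_mul, Units.coe_map, MonoidHom.coe_coe, IsUnit.unit_spec, map_intCast,
        Units.val_one] at this
      push_cast at this ⊢
      rw [← this]; norm_num
    rw [ZMod.natCast_eq_natCast_iff, Nat.modEq_iff_dvd] at h5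
    norm_num at h5
    have h6 : p ^ (c + 1) ∣ 3 := by exact_mod_cast h5
    have h7 := Nat.le_of_dvd (by norm_num) h6
    rcases hc with ⟨rfl, h5⟩ | ⟨rfl, rfl⟩
    · simp at h7; omega
    · norm_num at h7
  have hcop : Nat.Coprime e (p ^ a) :=
    Nat.Coprime.pow_right _ (((Nat.Prime.coprime_iff_not_dvd hp).2 hpe).symm)
  -- the obstruction `z` is a root of unity of order dividing `p ^ a`
  have hzq : z ^ (p ^ a) = 1 := by
    obtain ⟨ξ, hξ⟩ := h.exists_scalar (g := t ^ (p ^ a)) (by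
      rw [map_pow, ht, ← map_pow, ← x_natCast, hφ])
    have h1 : ι ξ = ι (ξ ^ N * z ^ (p ^ a)) := by
      have := h.conjHom_scalar (φ (dg u)) ξ
      rw [← hξ, map_pow, hz, h.scalar_mul_pow, ← pow_mul, mul_comm N, pow_mul, hξ, ← map_pow,
        ← map_mul] at this
      exact this.symm
    have h2 := h.injective h1
    have h3 : ξ ^ (p ^ c) = 1 := by
      apply h.injective
      rw [map_pow, ← hξ, ← pow_mul, ← pow_add, add_comm, htm, map_one]
    rw [heN, pow_succ, pow_mul, h3, one_pow, one_mul] at h2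
    simpa using h2.symm
  obtain ⟨X, X_add, hX, hdg⟩ := h.exists_equivariant_lift hm ht htm u N (p ^ c) e (p ^ a) hN heN
    (pow_pos hp.pos _) (pow_add p c a).symm hcop z hz hzq
  have hS := h.isSteinberg_rootPair (X_add := X_add) hX
    (h.equivariant_of_closure hgen (by rintro _ rfl; exact hdg))
    (h.torus_commute_of_closure hgen (by
      rintro _ rfl _ rfl; exact h.mem_liftCentralizer_self _))
  exact h.exists_hom_of_rootPair hm hX hS
    (RootPair.IsSteinberg.H_mul_of_odd hp hp2 (by omega) hS)

end IsScalarExtension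

/-! ### Powers of two -/

namespace IsScalarExtension

open SLTwo

variable {k G Q : Type*} [Field k] [Group G] [Group Q] {ι : kˣ →* G} {π : G →* Q}
  (h : IsScalarExtension ι π)
include h

lemma x_mem_liftCentralizer {m : ℕ} [NeZero m] (φ : SL(2, ZMod m) →* Q) (b c : ZMod m) :
    φ (x b) ∈ h.liftCentralizer (φ (x c)) := by
  have key : ∀ b : ZMod m, φ (x b) ∈ h.liftCentralizer (φ (x 1)) := by
    intro b
    rw [← ZMod.natCast_zmod_val b, x_natCast, map_pow]
    exact pow_mem (h.mem_liftCentralizer_self _) _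
  rw [← ZMod.natCast_zmod_val b, x_natCast, map_pow]
  refine pow_mem ?_ _
  rw [h.mem_liftCentralizer_comm]
  exact key c

/-- The lifts of `-1` commute with those of the standard unipotent element: the commutator `η`
satisfies `η ^ 2 = 1`, because `(-1) ^ 2 = 1`, and `η ^ 3 = 1`, because the Weyl element is a
product of three conjugates of the unipotent element and its square is `-1`. -/
lemma neg_one_mem_liftCentralizer_x {R : Type*} [CommRing R] (φ : SL(2, R) →* Q) :
    φ (dg (-1)) ∈ h.liftCentralizer (φ (x 1)) := by
  obtain ⟨t, ht⟩ := h.surjective (φ (x 1))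
  have hcentral : ∀ M : SL(2, R), dg (-1) * M * (dg (-1))⁻¹ = M := by
    intro M
    rw [mul_inv_eq_iff_eq_mul]
    simp [ext_iff', mul_apply]
  obtain ⟨η, hη⟩ : ∃ η, h.conjHom (φ (dg (-1))) t = t * ι η := by
    apply h.exists_eq_mul
    rw [h.map_conjHom, ht, ← map_inv, ← map_mul, ← map_mul, hcentral]
  have h2 : η ^ 2 = 1 := by
    have e : φ (dg (-1)) * φ (dg (-1)) = 1 := by
      rw [← map_mul, ← dg_mul]; simp [dg_one]
    have := congrArg (fun q => h.conjHom q t) e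
    simp only [map_mul, MulAut.mul_apply, hη, h.conjHom_scalar, map_one, MulAut.one_apply] at this
    apply h.injective
    rw [mul_assoc, mul_eq_left] at this
    rw [pow_two, map_mul, this, map_one]
  have h3 : η ^ 3 = 1 := by
    have e1 : h.conjHom (φ (dg (-1))) (h.conjHom (φ wt) t) = h.conjHom (φ wt) t * ι η := by
      have : (dg (-1) * wt : SL(2, R)) = wt * dg (-1) := by simp [ext_iff', mul_apply]
      rw [← MulAut.mul_apply, ← map_mul, ← map_mul, this, map_mul, map_mul, MulAut.mul_apply,
        hη, map_mul, h.conjHom_scalar]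
    have e2 : π (t * h.conjHom (φ wt) t * t) = φ wt := by
      have := x_yl_x (1 : Rˣ)
      simp only [Units.val_one, inv_one, dg_one, one_mul] at this
      rw [map_mul, map_mul, h.map_conjHom, ht, ← this, ← map_inv, ← map_mul, ← map_mul,
        ← map_mul, ← map_mul]
      congr 3
      simp only [this]
      rw [wt_x]; group
    have e3 : φ (dg (-1)) ∈ h.liftCentralizer (φ wt) := by
      rw [← wt_wt, map_mul]
      exact mul_mem (h.mem_liftCentralizer_self _) (h.mem_liftCentralizer_self _)
    have e4 := e3 _ e2
    rw [map_mul, map_mul, e1, hη] at e4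
    apply h.injective
    rw [map_pow, map_one]
    have c1 := h.central η t
    have c2 := h.central η (h.conjHom (φ wt) t)
    generalize h.conjHom (φ wt) t = y at *
    generalize ι η = c at *
    have : t * c * (y * c) * (t * c) = t * y * t * c ^ 3 := by
      simp only [mul_assoc, c1, c2, pow_succ, pow_zero, one_mul, ← mul_assoc c t, ← mul_assoc c y]
    rwa [this, mul_eq_left] at e4
  have h1 : η = 1 := by
    rw [pow_succ, h2, one_mul] at h3; exact h3
  obtain ⟨s, hs⟩ := h.surjective (φ (dg (-1)))
  rw [h.mem_liftCentralizer_iff ht hs]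
  rw [h1, map_one, mul_one, ← hs, h.conjHom_apply, mul_inv_eq_iff_eq_mul] at hη
  exact hη

lemma neg_one_mem_liftCentralizer {m : ℕ} (hm : 0 < m) (φ : SL(2, ZMod m) →* Q)
    (M : SL(2, ZMod m)) : φ (dg (-1)) ∈ h.liftCentralizer (φ M) := by
  rw [h.mem_liftCentralizer_comm]
  have : (⊤ : Subgroup _) ≤ (h.liftCentralizer (φ (dg (-1)))).comap φ := by
    rw [← closure_x_wt m hm, Subgroup.closure_le]
    rintro _ (rfl | rfl)
    · exact (h.mem_liftCentralizer_comm).1 (h.neg_one_mem_liftCentralizer_x φ)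
    · refine (h.mem_liftCentralizer_comm).1 ?_
      rw [← wt_wt, map_mul]
      exact mul_mem (h.mem_liftCentralizer_self _) (h.mem_liftCentralizer_self _)
  exact this (Subgroup.mem_top M)

/-- If conjugation by the lower unipotent `yl 2` fixes the image of `x b`, then the lifts of
`yl 4` commute with those of `x b`: up to an upper unipotent factor, `yl 2` is an element whose
square is `-1`. -/
lemma yl_four_mem_liftCentralizer {m : ℕ} (hm : 0 < m) (φ : SL(2, ZMod m) →* Q) (b : ZMod m)
    (hφ : φ (yl 2) * φ (x b) * (φ (yl 2))⁻¹ = φ (x b)) :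
    φ (yl 4) ∈ h.liftCentralizer (φ (x b)) := by
  have : NeZero m := ⟨hm.ne'⟩
  obtain ⟨M, hM⟩ := h.surjective (φ (x b))
  obtain ⟨ε, hε⟩ : ∃ ε, h.conjHom (φ (yl 2)) M = M * ι ε := by
    apply h.exists_eq_mul
    rw [h.map_conjHom, hM, hφ]
  -- `yl 2 * x (-1)` has the same effect on `M` as `yl 2`, and its square is `-1`
  have e1 : (yl 2 * x (-1)) * (yl 2 * x (-1)) = (dg (-1) : SL(2, ZMod m)) := by
    simp [ext_iff', mul_apply]; norm_num
  have e2 : h.conjHom (φ (yl 2 * x (-1))) M = M * ι ε := by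
    rw [map_mul, map_mul, MulAut.mul_apply, h.x_mem_liftCentralizer φ _ _ M hM, hε]
  have e3 := h.neg_one_mem_liftCentralizer hm φ _ M hM
  rw [← e1, map_mul, map_mul, MulAut.mul_apply, e2, map_mul, e2, h.conjHom_scalar] at e3
  have e4 : (yl 4 : SL(2, ZMod m)) = yl 2 * yl 2 := by rw [← yl_add]; norm_num
  obtain ⟨g, hg⟩ := h.surjective (φ (yl 4))
  rw [h.mem_liftCentralizer_iff hM hg, ← mul_inv_eq_iff_eq_mul, ← h.conjHom_apply, hg, e4,
    map_mul, map_mul, MulAut.mul_apply, hε, map_mul, hε, h.conjHom_scalar, e3]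

/-- The lifts of `diag(5, 5⁻¹)` commute with those of `x b`, because this matrix is a product of
unipotents of which the lower ones are powers of `yl 4`. -/
lemma dg_mem_liftCentralizer {m : ℕ} (hm : 0 < m) (φ : SL(2, ZMod m) →* Q) (b : ZMod m)
    (hφ : φ (yl 2) * φ (x b) * (φ (yl 2))⁻¹ = φ (x b)) (f : (ZMod m)ˣ) (hf : (f : ZMod m) = 5) :
    φ (dg f) ∈ h.liftCentralizer (φ (x b)) := by
  have : NeZero m := ⟨hm.ne'⟩
  have h1 := h.yl_four_mem_liftCentralizer hm φ b hφ
  have h2 : ∀ c, φ (yl (c * 4)) ∈ h.liftCentralizer (φ (x b)) := by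
    intro c
    rw [← ZMod.natCast_zmod_val c, yl_natCast_mul, map_pow]
    exact pow_mem h1 _
  have hf' : (5 : ZMod m) * (f⁻¹ : (ZMod m)ˣ) = 1 := by rw [← hf]; simp
  have e : dg f = yl (-((f⁻¹ : (ZMod m)ˣ) : ZMod m) * 4) * x 1 * yl (1 * 4) *
      x (-((f⁻¹ : (ZMod m)ˣ) : ZMod m)) := by
    simp only [ext_iff', mul_apply, dg_00, dg_01, dg_10, dg_11, x_00, x_01, x_10, x_11, yl_00,
      yl_01, yl_10, yl_11, hf]
    generalize ((f⁻¹ : (ZMod m)ˣ) : ZMod m) = g at *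
    refine ⟨?_, ?_, ?_, ?_⟩
    · ring
    · linear_combination hf'
    · linear_combination 4 * hf'
    · linear_combination (1 - 4 * g) * hf'
  rw [e, map_mul, map_mul, map_mul]
  exact mul_mem (mul_mem (mul_mem (h2 _) (h.x_mem_liftCentralizer φ _ _)) (h2 _))
    (h.x_mem_liftCentralizer φ _ _)

/-- A homomorphism from `SL₂(ℤ/2ᵃ⁺³)` to `Q` under which the images of `yl 2` and `x(2ᵃ)` commute
lifts to `G`. The hypothesis holds for homomorphisms inflated from level `2ᵃ⁺¹`. -/
theorem exists_hom_of_two [IsAlgClosed k] {a : ℕ} (φ : SL(2, ZMod (2 ^ (a + 3))) →* Q)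
    (hφ : φ (yl 2) * φ (x ((2 ^ a : ℕ) : ZMod (2 ^ (a + 3)))) * (φ (yl 2))⁻¹ =
      φ (x ((2 ^ a : ℕ) : ZMod (2 ^ (a + 3))))) :
    ∃ Φ : SL(2, ZMod (2 ^ (a + 3))) →* G, ∀ M, π (Φ M) = φ M := by
  have hm : 0 < 2 ^ (a + 3) := by positivity
  have : NeZero (2 ^ (a + 3)) := ⟨hm.ne'⟩
  have := ZMod.isLocalRing_prime_pow Nat.prime_two (b := a + 3) (by omega)
  have hm8 : 2 ^ (a + 3) = 8 * 2 ^ a := by ring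
  have h5u : IsUnit ((5 : ℤ) : ZMod (2 ^ (a + 3))) := by
    rw [ZMod.isUnit_prime_pow_iff Nat.prime_two (by omega)]; norm_num
  obtain ⟨f, hf⟩ : ∃ f : (ZMod (2 ^ (a + 3)))ˣ, (f : ZMod (2 ^ (a + 3))) = 5 :=
    ⟨h5u.unit, by simp⟩
  have hgen := ZMod.closure_neg_one_five (b := a + 3) (by omega) f hf
  have h25 : ((25 : ℕ) : ZMod (2 ^ (a + 3))) = f * f := by rw [hf]; norm_num
  obtain ⟨t, ht, htm⟩ := h.exists_lift_pow_eq_one hm φ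
  obtain ⟨z, hz⟩ := h.exists_conj_eq ht f 25 h25
  -- conjugation by the torus element fixes `t ^ (2 ^ a)`, which restricts the obstruction `z`
  have hzq : z ^ (2 ^ a) = 1 := by
    have e := h.dg_mem_liftCentralizer hm φ _ hφ f hf (t ^ 2 ^ a) (by
      rw [map_pow, ht, ← map_pow, ← x_natCast])
    have e' : (t ^ 25) ^ 2 ^ a = t ^ 2 ^ a := by
      rw [← pow_mul, show 25 * 2 ^ a = 2 ^ (a + 3) * 3 + 2 ^ a by ring, pow_add, pow_mul, htm,
        one_pow, one_mul]
    rw [map_pow, hz, h.scalar_mul_pow, e', mul_eq_left] at e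
    exact h.injective (e.trans (map_one ι).symm)
  obtain ⟨X, X_add, hX, hdg⟩ := h.exists_equivariant_lift hm ht htm f 25 8 3 (2 ^ a) h25 rfl
    (by norm_num) hm8.symm (Nat.Coprime.pow_right _ (by norm_num)) z hz hzq
  have hcomm := h.torus_commute_of_closure (φ := φ) hgen (by
    rintro _ (rfl | rfl) _ (rfl | rfl)
    · exact h.neg_one_mem_liftCentralizer hm φ _
    · exact h.neg_one_mem_liftCentralizer hm φ _
    · exact (h.mem_liftCentralizer_comm).1 (h.neg_one_mem_liftCentralizer hm φ _)
    · exact h.mem_liftCentralizer_self _)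
  have hneg : ∀ {X : ZMod (2 ^ (a + 3)) → G}, (∀ b, π (X b) = φ (x b)) →
      ∀ b, h.conjHom (φ (dg (-1))) (X b) =
        X (((-1 : (ZMod (2 ^ (a + 3)))ˣ) : ZMod (2 ^ (a + 3))) *
          ((-1 : (ZMod (2 ^ (a + 3)))ˣ) : ZMod (2 ^ (a + 3))) * b) := by
    intro X hX b
    rw [h.neg_one_mem_liftCentralizer hm φ _ _ (hX b)]
    simp
  have hS := h.isSteinberg_rootPair (X_add := X_add) hX
    (h.equivariant_of_closure hgen (by rintro _ (rfl | rfl); exacts [hneg hX, hdg])) hcomm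
  obtain ⟨haux, hmul⟩ := RootPair.IsSteinberg.H_neg_one_relations (by omega) hS
  -- the square of the lift of `-1` is a scalar `p = ±1`
  obtain ⟨p, hp⟩ := h.exists_scalar
    (g := (h.rootPair φ X X_add).H (-1) * (h.rootPair φ X X_add).H (-1)) (by
      rw [map_mul, h.map_rootPair_H hX, ← map_mul, ← dg_mul]; simp [dg_one])
  rw [hp] at haux hmul
  have hp2 : p = 1 ∨ p = -1 := by
    rw [← map_mul] at haux
    have := h.injective (haux.trans (map_one ι).symm)
    have := congrArg Units.val this
    rw [Units.val_mul, Units.val_one, mul_self_eq_one_iff] at this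
    exact this.imp (fun e => Units.ext e) fun e => Units.ext (by simpa using e)
  rcases hp2 with rfl | rfl
  · exact h.exists_hom_of_rootPair hm hX hS (hmul (map_one ι))
  -- when `p = -1`, the unipotent elements have to be multiplied by an eighth root of unity
  obtain ⟨θ, hθ⟩ := IsAlgClosed.exists_units_pow_eq (-1 : kˣ) (d := 4) (by norm_num)
  have hθ8 : θ ^ 8 = 1 := by rw [show 8 = 4 * 2 from rfl, pow_mul, hθ]; simp
  obtain ⟨Θ, Θ_add, hΘ⟩ := ZMod.exists_powers (m := 2 ^ (a + 3)) θ (by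
    rw [hm8, pow_mul, hθ8, one_pow])
  have Θ_sq : ∀ b, Θ (f * f * b) = Θ b := by
    intro b
    rw [← ZMod.natCast_zmod_val b, ← h25, ← Nat.cast_mul, hΘ, hΘ,
      show 25 * b.val = 8 * (3 * b.val) + b.val by ring, pow_add, pow_mul, hθ8, one_pow,
      one_mul]
  have X_add' : ∀ b c, X (b + c) * ι (Θ (b + c)) = X b * ι (Θ b) * (X c * ι (Θ c)) := by
    intro b c
    rw [X_add, Θ_add, map_mul, ← mul_assoc, mul_assoc (X b), ← h.central (Θ b) (X c)]
    group
  have hX' : ∀ b, π (X b * ι (Θ b)) = φ (x b) := by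
    intro b; rw [map_mul, hX, h.map_scalar, mul_one]
  have hS' := h.isSteinberg_rootPair (X := fun b => X b * ι (Θ b)) (X_add := X_add') hX'
    (h.equivariant_of_closure hgen (by
      rintro _ (rfl | rfl)
      · exact hneg hX'
      · intro b
        simp only [map_mul, hdg, h.conjHom_scalar, Θ_sq])) hcomm
  refine h.exists_hom_of_rootPair hm hX' hS'
    ((RootPair.IsSteinberg.H_neg_one_relations (by omega) hS').2 ?_)
  -- the twist multiplies `w` by `θ ^ 3` and hence `H(-1)²` by `θ ^ (-12) = -1`
  have hw : (h.rootPair φ (fun b => X b * ι (Θ b)) X_add').w =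
      (h.rootPair φ X X_add).w * ι (θ ^ 3) := by
    have hΘ1 : Θ 1 = θ := by simpa using hΘ 1
    simp only [rootPair, map_mul, h.conjHom_scalar, hΘ1]
    have c1 := h.central θ (X 1)
    have c2 := h.central θ (h.conjHom (φ wt) (X 1))
    rw [map_pow]
    generalize h.conjHom (φ wt) (X 1) = y at *
    generalize ι θ = c at *
    simp only [mul_assoc, c1, c2, pow_succ, pow_zero, one_mul, ← mul_assoc c (X 1),
      ← mul_assoc c y]
  rw [hS'.H_neg_one, hw]
  rw [hS.H_neg_one] at hp
  have hc := h.central (θ ^ 3) (h.rootPair φ X X_add).w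
  have hθ12 : ι (θ ^ 3) ^ 4 = ι (-1) := by
    rw [← map_pow, ← pow_mul, show 3 * 4 = 4 * 3 from rfl, pow_mul, hθ]
    norm_num [pow_succ]
  generalize (h.rootPair φ X X_add).w = w at *
  generalize ι (θ ^ 3) = c at *
  have hc' : Commute c w := hc
  have e : w * c * (w * c) = w * w * c ^ 2 := by rw [hc'.mul_mul_mul_comm, pow_two]
  have hcw : Commute c (w * w) := Commute.mul_right hc hc
  rw [← mul_inv_rev] at hp ⊢
  rw [inv_eq_iff_eq_inv] at hp
  rw [inv_eq_one, e, (hcw.pow_left 2).mul_mul_mul_comm, ← pow_add, hθ12, hp, inv_mul_cancel]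

end IsScalarExtension

/-! ### Lifts of representations of prime power level -/

namespace SLTwo

variable {R S : Type*} [CommRing R] [CommRing S]

lemma map_x (f : R →+* S) (b : R) : Matrix.SpecialLinearGroup.map f (x b) = x (f b) := by
  simp [ext_iff']

lemma map_yl (f : R →+* S) (b : R) : Matrix.SpecialLinearGroup.map f (yl b) = yl (f b) := by
  simp [ext_iff']

lemma map_castHom_red {m n : ℕ} (hmn : n ∣ m) (γ : SL(2, ℤ)) :
    Matrix.SpecialLinearGroup.map (ZMod.castHom hmn (ZMod n)) (red m γ) = red n γ := by
  simp [ext_iff']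

end SLTwo

namespace IsScalarExtension

open SLTwo

variable {k G Q : Type*} [Field k] [Group G] [Group Q] {ι : kˣ →* G} {π : G →* Q}
  (h : IsScalarExtension ι π)
include h

/-- Every homomorphism from `SL₂(ℤ/pᵃ)` to `Q` lifts to `G` after inflation to a level `pᵇ`
dividing `12 pᵃ`. -/
theorem exists_prime_power_lift [IsAlgClosed k] {p a : ℕ} (hp : p.Prime) (ha : a ≠ 0)
    (ψ : SL(2, ZMod (p ^ a)) →* Q) :
    ∃ b, p ^ b ∣ 12 * p ^ a ∧ ∃ Φ : SL(2, ZMod (p ^ b)) →* G,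
      ∀ γ : SL(2, ℤ), π (Φ (red _ γ)) = ψ (red _ γ) := by
  suffices ∃ b, p ^ b ∣ 12 * p ^ a ∧ ∃ hab : p ^ a ∣ p ^ b, ∃ Φ : SL(2, ZMod (p ^ b)) →* G,
      ∀ M, π (Φ M) =
        ψ.comp (Matrix.SpecialLinearGroup.map (ZMod.castHom hab (ZMod (p ^ a)))) M by
    obtain ⟨b, hb, hab, Φ, hΦ⟩ := this
    exact ⟨b, hb, Φ, fun γ => by rw [hΦ, MonoidHom.comp_apply, map_castHom_red]⟩
  have hzero : ∀ {b : ℕ} (hab : p ^ a ∣ p ^ b),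
      ψ.comp (Matrix.SpecialLinearGroup.map (ZMod.castHom hab (ZMod (p ^ a))))
        (x ((p ^ a : ℕ) : ZMod (p ^ b))) = 1 := by
    intro b hab
    rw [MonoidHom.comp_apply, map_x, map_natCast, ZMod.natCast_self, x_zero, map_one]
  by_cases hp2 : p = 2
  · subst hp2
    obtain ⟨a, rfl⟩ := Nat.exists_eq_succ_of_ne_zero ha
    refine ⟨a + 3, ⟨3, by rw [Nat.succ_eq_add_one]; ring⟩, pow_dvd_pow 2 (by omega), ?_⟩
    apply h.exists_hom_of_two
    -- modulo `2 ^ (a + 1)` the matrices `yl 2` and `x (2 ^ a)` commute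
    simp only [MonoidHom.comp_apply, map_x, map_yl, map_natCast, map_ofNat]
    have h0 : ((2 ^ a : ℕ) : ZMod (2 ^ a.succ)) * 2 = 0 := by
      have := ZMod.natCast_self (2 ^ a.succ)
      rw [pow_succ] at this
      exact_mod_cast this
    rw [mul_inv_eq_iff_eq_mul, ← map_mul, ← map_mul]
    congr 1
    simp only [ext_iff', mul_apply]
    simp
    grind
  · by_cases hp3 : p = 3
    · subst hp3
      exact ⟨1 + a, ⟨4, by ring⟩, pow_dvd_pow 3 (by omega),
        h.exists_hom_of_odd hp hp2 ha (Or.inr ⟨rfl, rfl⟩) _ (hzero _)⟩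
    · have hp5 : 5 ≤ p := by
        have := hp.two_le
        by_contra hlt
        have : p = 4 := by omega
        subst this
        exact absurd hp (by decide)
      exact ⟨0 + a, ⟨12, by rw [zero_add, mul_comm]⟩, pow_dvd_pow p (by omega),
        h.exists_hom_of_odd hp hp2 ha (Or.inl ⟨rfl, hp5⟩) _ (hzero _)⟩

end IsScalarExtension

/-! ### Characters of `SL₂(ℤ)` and lifts of representations of arbitrary level -/

namespace SLTwo

lemma Gamma_le_of_dvd {m n : ℕ} (hmn : n ∣ m) :
    CongruenceSubgroup.Gamma m ≤ CongruenceSubgroup.Gamma n := by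
  intro γ hγ
  rw [mem_Gamma_iff_red] at hγ ⊢
  rw [← map_castHom_red hmn, hγ, map_one]

lemma wt_eq_x_mul {R : Type*} [CommRing R] :
    (wt : SL(2, R)) = x 1 * (wt * x 1 * wt⁻¹) * x 1 := by
  have := x_yl_x (1 : Rˣ)
  simp only [Units.val_one, inv_one, dg_one, one_mul] at this
  rw [wt_x, mul_inv_cancel_right, this]

lemma eq_top_of_mem {N : ℕ} (hN : 0 < N) {K : Subgroup SL(2, ZMod N)} (h1 : x 1 ∈ K)
    (h2 : wt * x 1 * wt⁻¹ ∈ K) : K = ⊤ := by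
  rw [eq_top_iff, ← closure_x_wt N hN, Subgroup.closure_le]
  rintro _ (rfl | rfl)
  · exact h1
  · rw [wt_eq_x_mul]
    exact mul_mem (mul_mem h1 h2) h1

lemma T_eq_x : ModularGroup.T = x 1 := rfl

lemma S_eq_wt_inv : ModularGroup.S = wt⁻¹ := by
  rw [eq_inv_iff_mul_eq_one]
  rw [ext_iff']
  simp only [mul_apply]
  simp [ModularGroup.S]

lemma apply_wt_eq_pow {R A : Type*} [CommRing R] [CommGroup A] (χ : SL(2, R) →* A) :
    χ wt = χ (x 1) ^ 3 := by
  conv_lhs => rw [wt_eq_x_mul]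
  rw [map_mul, map_mul, map_mul, map_mul, map_inv, mul_comm (χ wt), mul_inv_cancel_right]
  simp only [pow_succ, pow_zero, one_mul]

/-- A character of `SL₂(ℤ)` is determined by its value at the unipotent generator. -/
lemma monoidHom_eq_of_apply_x {A : Type*} [CommGroup A] {χ χ' : SL(2, ℤ) →* A}
    (hx : χ (x 1) = χ' (x 1)) : χ = χ' := by
  apply MonoidHom.eq_of_eqOn_dense _root_.SpecialLinearGroup.SL2Z_generators
  rintro _ (rfl | rfl)
  · rw [S_eq_wt_inv, map_inv, map_inv, apply_wt_eq_pow, apply_wt_eq_pow, hx]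
  · rwa [T_eq_x]

/-- A character of `SL₂(ℤ/N)` with prescribed value at the unipotent generator. The two conditions
on the units hold for `N = 3` and `N = 4`. -/
lemma exists_character {A : Type*} [CommGroup A] {N : ℕ} (hN : 0 < N) [IsLocalRing (ZMod N)]
    (hsq : ∀ u : (ZMod N)ˣ, (u : ZMod N) * u = 1)
    (hmul : ∀ u v : (ZMod N)ˣ, (3 : ZMod N) * (u - 1) * (v - 1) = 0)
    {ζ : A} (hζ : ζ ^ N = 1) : ∃ Φ : SL(2, ZMod N) →* A, Φ (x 1) = ζ := by
  obtain ⟨X, X_add, hX⟩ := ZMod.exists_powers ζ hζ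
  -- in an abelian group the Weyl element `x(1) y(-1) x(1)` becomes `X 3`
  let D : RootPair (ZMod N) A := ⟨X, X 3, X_add⟩
  have hinv : ∀ u : (ZMod N)ˣ, u⁻¹ = u := fun u => by
    rw [inv_eq_iff_mul_eq_one]; exact Units.ext (hsq u)
  have hW : ∀ u, D.W u = X (3 * u) := by
    intro u
    rw [RootPair.W, RootPair.Y, mul_comm D.w, mul_inv_cancel_right, hinv, neg_neg]
    change X u * X u * X u = _
    rw [← X_add, ← X_add]; ring_nf
  have hD : D.IsSteinberg :=
    { W_one := by rw [hW]; simp [D]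
      w_sq_X := fun b => mul_comm _ _
      H_X := fun u b => by rw [hsq, one_mul, mul_comm]
      H_Y := fun u b => by rw [hinv, hsq, one_mul, mul_comm]
      H_comm := fun u v => mul_comm _ _ }
  obtain ⟨Φ, hΦ, -⟩ := hD.exists_hom (fun u v => by
    rw [RootPair.H, RootPair.H, RootPair.H, hW, hW, hW]
    change X _ * (X 3)⁻¹ = X _ * (X 3)⁻¹ * (X _ * (X 3)⁻¹)
    have e : X (3 * (u * v : (ZMod N)ˣ)) * X 3 = X (3 * u) * X (3 * v) := by
      rw [← X_add, ← X_add]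
      congr 1
      push_cast
      linear_combination hmul u v
    rw [eq_mul_inv_iff_mul_eq.2 e, mul_assoc _ (X 3)⁻¹, mul_mul_mul_comm]) (closure_x_wt N hN)
  refine ⟨Φ, hΦ.trans ?_⟩
  simpa using hX 1

/-- Every character of `SL₂(ℤ)` is trivial on `Γ(12)`. -/
lemma character_apply_eq_one {A : Type*} [CommGroup A] (χ : SL(2, ℤ) →* A) {γ : SL(2, ℤ)}
    (hγ : γ ∈ CongruenceSubgroup.Gamma 12) : χ γ = 1 := by
  -- `ζ = ζ ^ 4 * ζ ^ (-3)`, and the two factors are a cube root and a fourth root of unity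
  set ζ := χ (x 1)
  have h12 : (ζ ^ 4) ^ 3 = 1 := by
    have h4 : (wt * wt * (wt * wt) : SL(2, ℤ)) = 1 := by rw [wt_wt, ← dg_mul]; simp [dg_one]
    have := congrArg χ h4
    rw [map_mul, map_mul, apply_wt_eq_pow, map_one, ← pow_add, ← pow_add] at this
    rw [← pow_mul]
    exact this
  have h12' : ((ζ ^ 3)⁻¹) ^ (2 ^ 2) = 1 := by
    rw [inv_pow, inv_eq_one, ← pow_mul, ← h12, ← pow_mul]; norm_num
  have := ZMod.isLocalRing_prime_pow Nat.prime_two (b := 2) (by norm_num)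
  have := ZMod.isLocalRing_prime_pow Nat.prime_three (b := 1) (by norm_num)
  obtain ⟨Φ, hΦ⟩ := exists_character (N := 3 ^ 1) (by norm_num) (by decide) (by decide) h12
  obtain ⟨Ψ, hΨ⟩ := exists_character (N := 2 ^ 2) (by norm_num) (by decide) (by decide) h12'
  have hχ : χ = Φ.comp (red (3 ^ 1)) * Ψ.comp (red (2 ^ 2)) := by
    apply monoidHom_eq_of_apply_x
    rw [MonoidHom.mul_apply, MonoidHom.comp_apply, MonoidHom.comp_apply, ← T_eq_x, red_T, red_T,
      hΦ, hΨ, T_eq_x, eq_mul_inv_iff_mul_eq, pow_succ' ζ 3]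
  have h3 := mem_Gamma_iff_red.1 (Gamma_le_of_dvd (n := 3 ^ 1) (by norm_num) hγ)
  have h4 := mem_Gamma_iff_red.1 (Gamma_le_of_dvd (n := 2 ^ 2) (by norm_num) hγ)
  rw [hχ, MonoidHom.mul_apply, MonoidHom.comp_apply, MonoidHom.comp_apply, h3, h4, map_one,
    map_one, one_mul]

end SLTwo

namespace IsScalarExtension

open SLTwo

variable {k G Q : Type*} [Field k] [Group G] [Group Q] {ι : kˣ →* G} {π : G →* Q}
  (h : IsScalarExtension ι π)
include h

/-- The lifts of the images of the two factors of `SL₂(ℤ/q) × SL₂(ℤ/n)` commute, because the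
unipotent generators of both factors are images of powers of `T`. -/
lemma mem_liftCentralizer_of_coprime {q n : ℕ} (hq : 0 < q) (hn : 0 < n) (hqn : q.Coprime n)
    (f : SL(2, ℤ) →* G) (ψ : SL(2, ZMod q) →* Q) (χ : SL(2, ZMod n) →* Q)
    (hcomm : ∀ A B, Commute (ψ A) (χ B))
    (hf : ∀ γ, π (f γ) = ψ (red q γ) * χ (red n γ)) (A : SL(2, ZMod q)) (B : SL(2, ZMod n)) :
    ψ A ∈ h.liftCentralizer (χ B) := by
  obtain ⟨c, hc1, hc2⟩ := Nat.chineseRemainder hqn 1 0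
  obtain ⟨d, hd1, hd2⟩ := Nat.chineseRemainder hqn 0 1
  rw [← ZMod.natCast_eq_natCast_iff] at hc1 hc2 hd1 hd2
  have e1 : π (f (ModularGroup.T ^ c)) = ψ (x 1) := by
    rw [hf, map_pow (red q), map_pow (red n), red_T, red_T, ← x_natCast, ← x_natCast, hc1, hc2]
    simp [x_zero]
  have e2 : π (f (ModularGroup.T ^ d)) = χ (x 1) := by
    rw [hf, map_pow (red q), map_pow (red n), red_T, red_T, ← x_natCast, ← x_natCast, hd1, hd2]
    simp [x_zero]
  have h0 : ψ (x 1) ∈ h.liftCentralizer (χ (x 1)) := by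
    rw [h.mem_liftCentralizer_iff e2 e1, ← map_mul, ← map_mul, ← pow_add, ← pow_add, add_comm]
  have h1 : ∀ A, ψ A ∈ h.liftCentralizer (χ (x 1)) := by
    intro A
    have : (h.liftCentralizer (χ (x 1))).comap ψ = ⊤ := by
      refine eq_top_of_mem hq h0 ?_
      have := h.conj_mem_liftCentralizer h0 (ψ wt)
      rwa [(hcomm wt (x 1)).eq, mul_inv_cancel_right, ← map_inv, ← map_mul, ← map_mul] at this
    rw [← Subgroup.mem_comap, this]; trivial
  rw [h.mem_liftCentralizer_comm]
  have : (h.liftCentralizer (ψ A)).comap χ = ⊤ := by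
    have h2 := (h.mem_liftCentralizer_comm).1 (h1 A)
    refine eq_top_of_mem hn h2 ?_
    have := h.conj_mem_liftCentralizer h2 (χ wt)
    rwa [← (hcomm A wt).eq, mul_inv_cancel_right, ← map_inv, ← map_mul, ← map_mul] at this
  rw [← Subgroup.mem_comap, this]; trivial

/-- A linear lift of a homomorphism `SL₂(ℤ) → Q` that is trivial on `Γ(n)` is trivial on
`Γ(12 n)`. The proof is by induction on `n`, splitting off prime powers. -/
theorem apply_eq_one_of_mem_Gamma [IsAlgClosed k] {n : ℕ} (hn : 0 < n) (f : SL(2, ℤ) →* G)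
    (hf : ∀ γ ∈ CongruenceSubgroup.Gamma n, π (f γ) = 1) {γ : SL(2, ℤ)}
    (hγ : γ ∈ CongruenceSubgroup.Gamma (12 * n)) : f γ = 1 := by
  induction n using Nat.recOnPrimePow generalizing f γ with
  | zero => exact absurd hn (lt_irrefl 0)
  | one =>
    have hf' : ∀ γ, ∃ z, f γ = ι z := by
      intro γ
      apply h.exists_scalar
      apply hf
      rw [CongruenceSubgroup.Gamma_one_top]; trivial
    choose z hz using hf'
    let χ : SL(2, ℤ) →* kˣ := MonoidHom.mk' z fun a b => by
      apply h.injective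
      rw [← hz, map_mul, map_mul, hz, hz]
    have : z γ = 1 := character_apply_eq_one χ (by simpa using hγ)
    rw [hz, this, map_one]
  | prime_pow_mul n p e hp hpn he ih =>
    have hn0 : 0 < n := Nat.pos_of_mul_pos_left hn
    have hq0 : 0 < p ^ e := pow_pos hp.pos e
    have hcop : (p ^ e).Coprime n :=
      Nat.Coprime.pow_left e ((Nat.Prime.coprime_iff_not_dvd hp).2 hpn)
    let F := (red (p ^ e)).prod (red n)
    have hF : Function.Surjective F := by
      rintro ⟨A, B⟩
      obtain ⟨α, rfl⟩ := red_surjective _ hq0 A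
      obtain ⟨β, rfl⟩ := red_surjective _ hn0 B
      obtain ⟨δ, h1, h2⟩ := exists_Gamma_mul hq0 hn0 (γ := β⁻¹ * α) (by
        rw [hcop, CongruenceSubgroup.Gamma_one_top]; trivial)
      refine ⟨β * δ, Prod.ext ?_ ?_⟩
      · change red _ _ = red _ _
        rw [map_mul, h1, ← map_mul, mul_inv_cancel_left]
      · change red _ _ = red _ _
        rw [map_mul, h2, mul_one]
    have hker : F.ker ≤ (π.comp f).ker := by
      intro γ hγ
      have hγ' : red (p ^ e) γ = 1 ∧ red n γ = 1 := by
        have := MonoidHom.mem_ker.1 hγ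
        exact ⟨congrArg Prod.fst this, congrArg Prod.snd this⟩
      apply hf
      rw [← mem_Gamma_iff_red, ← mem_Gamma_iff_red] at hγ'
      simp only [CongruenceSubgroup.Gamma_mem] at hγ' ⊢
      have key : ∀ s t : ℤ, (s : ZMod (p ^ e)) = t → (s : ZMod n) = t →
          (s : ZMod (p ^ e * n)) = t := by
        intro s t h1 h2
        rw [ZMod.intCast_eq_intCast_iff_dvd_sub] at h1 h2 ⊢
        push_cast at h1 ⊢
        exact IsCoprime.mul_dvd (by exact_mod_cast Nat.isCoprime_iff_coprime.2 hcop) h1 h2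
      obtain ⟨⟨a1, a2, a3, a4⟩, b1, b2, b3, b4⟩ := hγ'
      refine ⟨?_, ?_, ?_, ?_⟩
      · exact_mod_cast key _ 1 (by exact_mod_cast a1) (by exact_mod_cast b1)
      · exact_mod_cast key _ 0 (by exact_mod_cast a2) (by exact_mod_cast b2)
      · exact_mod_cast key _ 0 (by exact_mod_cast a3) (by exact_mod_cast b3)
      · exact_mod_cast key _ 1 (by exact_mod_cast a4) (by exact_mod_cast b4)
    -- the induced homomorphism from the product of the two finite groups
    let fbar := F.liftOfSurjective hF ⟨π.comp f, hker⟩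
    have hfbar : ∀ γ, fbar (red _ γ, red _ γ) = π (f γ) := fun γ =>
      MonoidHom.liftOfRightInverse_comp_apply _ _ _ _ γ
    let ψ := fbar.comp (MonoidHom.inl _ _)
    let χ := fbar.comp (MonoidHom.inr _ _)
    have hfac : ∀ γ, π (f γ) = ψ (red _ γ) * χ (red _ γ) := by
      intro γ
      rw [← hfbar]
      simp [ψ, χ, ← map_mul]
    have hcomm : ∀ A B, Commute (ψ A) (χ B) := fun A B =>
      (MonoidHom.commute_inl_inr A B).map fbar
    have hlift := h.mem_liftCentralizer_of_coprime hq0 hn0 hcop f ψ χ hcomm hfac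
    obtain ⟨b, hb, Φ, hΦ⟩ := h.exists_prime_power_lift hp he.ne' ψ
    have hg : ∀ γ, π ((Φ (red _ γ))⁻¹ * f γ) = χ (red _ γ) := by
      intro γ
      rw [map_mul, map_inv, hΦ, hfac, inv_mul_cancel_left]
    -- the part of `f` that factors, modulo scalars, through the reduction modulo `n`
    let g : SL(2, ℤ) →* G := MonoidHom.mk' (fun γ => (Φ (red _ γ))⁻¹ * f γ) fun α β => by
      have hcm : Commute (Φ (red _ β)) ((Φ (red _ α))⁻¹ * f α) :=
        (h.mem_liftCentralizer_iff (hg α) (hΦ β)).1 (hlift _ _)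
      rw [map_mul, map_mul, map_mul, mul_inv_rev, mul_assoc, ← mul_assoc _ (f α), ← mul_assoc,
        hcm.inv_left.eq, mul_assoc]
    have hgγ : g γ = 1 := by
      refine ih hn0 g (fun γ hγ => ?_) ?_
      · rw [mem_Gamma_iff_red] at hγ
        rw [← map_one χ, ← hγ]
        exact hg γ
      · exact Gamma_le_of_dvd ⟨p ^ e, by ring⟩ hγ
    have hγb : red (p ^ b) γ = 1 := by
      rw [← mem_Gamma_iff_red]
      exact Gamma_le_of_dvd (hb.trans ⟨n, by ring⟩) hγ
    change (Φ (red _ γ))⁻¹ * f γ = 1 at hgγ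
    rwa [hγb, map_one, inv_one, one_mul] at hgγ

end IsScalarExtension

/-! ### The projective linear group and levels of congruence subgroups -/

/-- The general linear group as an extension of the projective one by the scalar matrices. -/
lemma Matrix.GeneralLinearGroup.isScalarExtension {k : Type*} [Field k] {r : ℕ} (hr : 0 < r) :
    IsScalarExtension (Matrix.GeneralLinearGroup.scalar (Fin r) : kˣ →* GL (Fin r) k)
      Matrix.ProjGenLinGroup.mk where
  injective a b hab := by
    have := congrArg (fun g : GL (Fin r) k => (g : Matrix (Fin r) (Fin r) k) ⟨0, hr⟩ ⟨0, hr⟩) hab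
    ext
    simpa using this
  central z g := by
    have : Matrix.GeneralLinearGroup.scalar (Fin r) z ∈ Subgroup.center (GL (Fin r) k) := by
      rw [Matrix.GeneralLinearGroup.center_eq_range_scalar]; exact ⟨z, rfl⟩
    exact ((Subgroup.mem_center_iff.1 this) g).symm
  surjective := Matrix.ProjGenLinGroup.mk_surjective
  ker_eq := by
    rw [Matrix.ProjGenLinGroup.ker_mk, Matrix.GeneralLinearGroup.center_eq_range_scalar]

open SLTwo in
/-- If `L` contains `Γ(m)` and `Γ(n)`, then it contains `Γ(gcd(m, n))`. -/
lemma CongruenceSubgroup.Gamma_gcd_le {L : Subgroup SL(2, ℤ)} {m n : ℕ} (hm : 0 < m) (hn : 0 < n)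
    (hmL : CongruenceSubgroup.Gamma m ≤ L) (hnL : CongruenceSubgroup.Gamma n ≤ L) :
    CongruenceSubgroup.Gamma (Nat.gcd m n) ≤ L := by
  intro γ hγ
  obtain ⟨δ, h1, h2⟩ := exists_Gamma_mul hm hn hγ
  rw [← mul_inv_cancel_left δ γ]
  refine mul_mem (hnL (mem_Gamma_iff_red.2 h2)) (hmL (mem_Gamma_iff_red.2 ?_))
  rw [map_mul, map_inv, h1, inv_mul_cancel]

/-- The level of a congruence subgroup divides every `m` with `Γ(m) ≤ L`. -/
lemma IsCongruenceSubgroupOfLevel.dvd {L : Subgroup SL(2, ℤ)} {m n : ℕ}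
    (hn : IsCongruenceSubgroupOfLevel L n) (hm : 0 < m) (hmL : CongruenceSubgroup.Gamma m ≤ L) :
    n ∣ m := by
  obtain ⟨⟨hn0, hnL⟩, hmin⟩ := hn
  have h1 : n ≤ Nat.gcd m n :=
    hmin ⟨Nat.gcd_pos_of_pos_left _ hm, CongruenceSubgroup.Gamma_gcd_le hm hn0 hmL hnL⟩
  have h2 : Nat.gcd m n = n := le_antisymm (Nat.gcd_le_right _ hn0) h1
  exact h2 ▸ Nat.gcd_dvd_left m n

theorem theorem2p3 {k : Type*} [Field k] [IsAlgClosed k] [CharZero k]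
    (r : ℕ) (hr : 0 < r)
    (ρbar : SL(2, ℤ) →* Matrix.ProjGenLinGroup (Fin r) k)
    (n : ℕ) (hn : IsCongruenceSubgroupOfLevel ρbar.ker n)
    (ρ : SL(2, ℤ) →* GL (Fin r) k) (hρ : IsLinearLifting ρ ρbar) :
    ∃ m : ℕ, IsCongruenceSubgroupOfLevel ρ.ker m ∧ n ∣ m ∧ m ∣ 12 * n := by
  have hn0 : 0 < n := hn.1.1
  have hmk : ∀ γ, Matrix.ProjGenLinGroup.mk (ρ γ) = ρbar γ := fun γ => DFunLike.congr_fun hρ γ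
  have h12 : CongruenceSubgroup.Gamma (12 * n) ≤ ρ.ker := fun γ hγ =>
    (Matrix.GeneralLinearGroup.isScalarExtension hr).apply_eq_one_of_mem_Gamma hn0 ρ
      (fun γ hγ => (hmk γ).trans (hn.1.2 hγ)) hγ
  have hex : ∃ m, 0 < m ∧ CongruenceSubgroup.Gamma m ≤ ρ.ker := ⟨12 * n, by omega, h12⟩
  classical
  have hlevel : IsCongruenceSubgroupOfLevel ρ.ker (Nat.find hex) :=
    ⟨Nat.find_spec hex, fun m hm => Nat.find_min' hex hm⟩
  refine ⟨Nat.find hex, hlevel, hn.dvd hlevel.1.1 fun γ hγ => ?_, hlevel.dvd (by omega) h12⟩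
  have h1 : ρ γ = 1 := hlevel.1.2 hγ
  rw [MonoidHom.mem_ker, ← hmk, h1, map_one]
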